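/- Let $\Omega$ be a bounded open interval $(a,b)$, $a<b$, or $\Omega=\mathbb R$; let $\alpha>0$, $m:=\lfloor\alpha\rfloor$, and $1\le p<\infty$. All functions are real valued. For $\varphi\in C_0^\infty(\Omega)$, extended by zero to $\tilde\varphi:\mathbb R\to\mathbb R$, and for $0<\sigma\le 1$, put $${}^-I^{\sigma}\tilde\varphi(x)=\frac1{\Gamma(\sigma)}\int_{-\infty}^x (x-y)^{\sigma-1}\tilde\varphi(y)\,dy,\qquad {}^+I^{\sigma}\tilde\varphi(x)=\frac1{\Gamma(\sigma)}\int_x^{\infty}(y-x)^{\sigma-1}\tilde\varphi(y)\,dy,$$ and let $${}^-D^\alpha\tilde\varphi=\frac{d^{m+1}}{dx^{m+1}}\,{}^-I^{m+1-\alpha}\tilde\varphi,\qquad {}^+D^\alpha\tilde\varphi=-\frac{d^{m+1}}{dx^{m+1}}\,{}^+I^{m+1-\alpha}\tilde\varphi$$ be the left and right Riemann–Liouville derivatives. For $u\in L^p(\Omega)$, a function $v\in L^1_{loc}(\Omega)$ is called the left (resp. right) weak fractional derivative ${}^{-}\mathcal D^\alpha u$ (resp. ${}^{+}\mathcal D^\alpha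 u$) if $$\int_\Omega v\,\varphi\,dx=(-1)^{m}\int_\Omega u\;{}^{\mp}D^\alpha\tilde\varphi\,dx\qquad\text{for all }\varphi\in C_0^\infty(\Omega),$$ so the left weak derivative is tested with ${}^+D^\alpha\tilde\varphi$ and the right one with ${}^-D^\alpha\tilde\varphi$. The one-sided fractional Sobolev spaces are $${}^{\pm}W^{\alpha,p}(\Omega)=\{u\in W^{m,p}(\Omega):\ {}^{\pm}\mathcal D^\alpha u\in L^p(\Omega)\},\qquad \|u\|_{{}^{\pm}W^{\alpha,p}(\Omega)}=\Bigl(\sum_{k=0}^{m}\|\mathcal D^k u\|_{L^p(\Omega)}^p+\|{}^{\pm}\mathcal D^\alpha u\|_{L^p(\Omega)}^p\Bigr)^{1/p},$$ where $\mathcal D^k$ is the ordinary weak derivative. Let ${}^{\pm}\overline W^{\alpha,p}(\Omega)$ be the completion, in this norm, of the space of the functions in $C^\infty(\Omega)$ that belong to ${}^{\pm}W^{\alpha,p}(\Omega)$ (that is, whose norm is defined and finite). **Theorem.** For each of the two signs, ${}^{\pm}\overline W^{\alpha,p}(\Omega)={}^{\pm}W^{\alpha,p}(\Omega)$. That is,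 the inclusion of $C^\infty(\Omega)\cap{}^{\pm}W^{\alpha,p}(\Omega)$ into ${}^{\pm}W^{\alpha,p}(\Omega)$ extends to a linear isometric isomorphism of the completion ${}^{\pm}\overline W^{\alpha,p}(\Omega)$ onto ${}^{\pm}W^{\alpha,p}(\Omega)$; in particular $C^\infty(\Omega)\cap{}^{\pm}W^{\alpha,p}(\Omega)$ is dense in ${}^{\pm}W^{\alpha,p}(\Omega)$. -/

import Mathlib

open MeasureTheory Set TopologicalSpace
open scoped ENNReal ContDiff

noncomputable section

/-- The two directions, `-` (left) and `+` (right). -/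
inductive Side where
  | left : Side
  | right : Side

/-- The opposite direction. -/
def Side.opp : Side → Side
  | .left => .right
  | .right => .left

/-- The Riemann-Liouville fractional integral of order `σ > 0` on the real line:
`Γ(σ)⁻¹ ∫_{-∞}^x (x - y)^(σ - 1) f(y) dy` (left) and
`Γ(σ)⁻¹ ∫_x^∞ (y - x)^(σ - 1) f(y) dy` (right). -/
def fracIntegral (s : Side) (σ : ℝ) (f : ℝ → ℝ) (x : ℝ) : ℝ :=
  match s with
  | .left => (Real.Gamma σ)⁻¹ * ∫ y in Iio x, (x - y) ^ (σ - 1) * f y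
  | .right => (Real.Gamma σ)⁻¹ * ∫ y in Ioi x, (y - x) ^ (σ - 1) * f y

/-- The classical left / right Riemann-Liouville derivative of order `α` on the real line, with
`m = ⌊α⌋` and `n = m + 1`: the left one is `(d/dx)^n I^{n - α} f`, the right one is
`-(d/dx)^n I^{n - α} f = (d/dx)^m (-(d/dx) I^{1 - (α - m)} f)`.
For a natural number `α` both are the ordinary derivative of order `α` of a test function.
The sign of the right derivative is the one for which the integration by parts formula
`∫ f D^α_left g = (-1)^m ∫ g D^α_right f` holds for test functions and for which the right
derivative of order `α` is the `m`-th derivative of the right derivative of order `α - m`; another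
widespread normalization, `(-1)^n (d/dx)^n I^{n - α} f`, differs from it by the constant factor
`(-1)^m`, which affects neither the function spaces below nor their norms. -/
def rlDeriv (s : Side) (α : ℝ) (f : ℝ → ℝ) (x : ℝ) : ℝ :=
  match s with
  | .left => iteratedDeriv (⌊α⌋₊ + 1) (fracIntegral .left ((⌊α⌋₊ + 1 : ℕ) - α) f) x
  | .right => -iteratedDeriv (⌊α⌋₊ + 1) (fracIntegral .right ((⌊α⌋₊ + 1 : ℕ) - α) f) x

/-- `φ ∈ C₀^∞(Ω)`; such a function on the line is its own extension by zero. -/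
structure IsTestFunction (Ω : Opens ℝ) (φ : ℝ → ℝ) : Prop where
  smooth : ContDiff ℝ ∞ φ
  compact : HasCompactSupport φ
  support : tsupport φ ⊆ Ω

/-- `v ∈ L¹_loc(Ω)` is the dual derivative of `u` with respect to the operator `T` on test
functions and the sign `c`: `∫_Ω v φ = c ∫_Ω u (T φ)` for all `φ ∈ C₀^∞(Ω)`, where the
pairing on the right is required to be absolutely convergent. -/
def HasDualDeriv (Ω : Opens ℝ) (c : ℝ) (T : (ℝ → ℝ) → ℝ → ℝ) (u v : ℝ → ℝ) : Prop :=
  LocallyIntegrableOn v Ω ∧ ∀ φ, IsTestFunction Ω φ →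
    IntegrableOn (fun x => u x * T φ x) Ω ∧
      ∫ x in (Ω : Set ℝ), v x * φ x = c * ∫ x in (Ω : Set ℝ), u x * T φ x

/-- `v` is the weak derivative of order `k` of `u` on `Ω`. -/
def HasWeakDeriv (Ω : Opens ℝ) (k : ℕ) (u v : ℝ → ℝ) : Prop :=
  HasDualDeriv Ω ((-1) ^ k) (fun φ => iteratedDeriv k φ) u v

/-- `v` is the left / right weak fractional derivative of order `α` of `u` on `Ω`:
`∫_Ω v φ = (-1)^⌊α⌋ ∫_Ω u D^α φ` for all test functions `φ` on `Ω`, where `D^α` is the classical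
derivative in the opposite direction of the zero extension of `φ`. -/
def HasWeakFracDeriv (s : Side) (α : ℝ) (Ω : Opens ℝ) (u v : ℝ → ℝ) : Prop :=
  HasDualDeriv Ω ((-1) ^ ⌊α⌋₊) (fun φ => rlDeriv s.opp α φ) u v

/-- The space `L^p(Ω)`. -/
abbrev LpOn (p : ℝ≥0∞) (Ω : Opens ℝ) : Type :=
  Lp ℝ p (volume.restrict (Ω : Set ℝ))

section DualDeriv

variable {Ω : Opens ℝ} {c : ℝ} {T : (ℝ → ℝ) → ℝ → ℝ} {p : ℝ≥0∞}

theorem LpOn.locallyIntegrableOn (hp : 1 ≤ p) (f : LpOn p Ω) :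
    LocallyIntegrableOn (f : ℝ → ℝ) Ω :=
  locallyIntegrableOn_of_locallyIntegrable_restrict ((Lp.memLp f).locallyIntegrable hp)

theorem IsTestFunction.integrable_mul {φ v : ℝ → ℝ} (hφ : IsTestFunction Ω φ)
    (hv : LocallyIntegrableOn v Ω) : IntegrableOn (fun x => v x * φ x) Ω := by
  have h1 : IntegrableOn v (tsupport φ) :=
    hv.integrableOn_compact_subset hφ.support hφ.compact
  have h2 : IntegrableOn (fun x => v x * φ x) (tsupport φ) :=
    h1.mul_continuousOn hφ.smooth.continuous.continuousOn hφ.compact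
  have h3 : Integrable (fun x => v x * φ x) := by
    refine (integrableOn_iff_integrable_of_support_subset ?_).1 h2
    intro x hx
    exact subset_tsupport _ (right_ne_zero_of_mul hx)
  exact h3.integrableOn

theorem HasDualDeriv.congr {u u' v v' : ℝ → ℝ} (h : HasDualDeriv Ω c T u v)
    (hu : u =ᵐ[volume.restrict (Ω : Set ℝ)] u') (hv : v =ᵐ[volume.restrict (Ω : Set ℝ)] v')
    (hv' : LocallyIntegrableOn v' Ω) : HasDualDeriv Ω c T u' v' := by
  refine ⟨hv', fun φ hφ => ?_⟩
  obtain ⟨h1, h2⟩ := h.2 φ hφ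
  have e1 : (fun x => u x * T φ x) =ᵐ[volume.restrict (Ω : Set ℝ)] fun x => u' x * T φ x := by
    filter_upwards [hu] with x hx
    rw [hx]
  have e2 : (fun x => v x * φ x) =ᵐ[volume.restrict (Ω : Set ℝ)] fun x => v' x * φ x := by
    filter_upwards [hv] with x hx
    rw [hx]
  exact ⟨h1.congr e1, by rw [← integral_congr_ae e1, ← integral_congr_ae e2, h2]⟩

theorem HasDualDeriv.add {u u' v v' : ℝ → ℝ} (h : HasDualDeriv Ω c T u v)
    (h' : HasDualDeriv Ω c T u' v') : HasDualDeriv Ω c T (u + u') (v + v') := by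
  refine ⟨h.1.add h'.1, fun φ hφ => ?_⟩
  obtain ⟨h1, h2⟩ := h.2 φ hφ
  obtain ⟨h1', h2'⟩ := h'.2 φ hφ
  have e1 : (fun x => (u + u') x * T φ x) = fun x => u x * T φ x + u' x * T φ x := by
    ext x
    simp [add_mul]
  have e2 : (fun x => (v + v') x * φ x) = fun x => v x * φ x + v' x * φ x := by
    ext x
    simp [add_mul]
  refine ⟨by rw [e1]; exact h1.add h1', ?_⟩
  rw [e1, e2, integral_add (hφ.integrable_mul h.1) (hφ.integrable_mul h'.1),
    integral_add h1 h1', h2, h2', mul_add]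

theorem HasDualDeriv.smul {u v : ℝ → ℝ} (r : ℝ) (h : HasDualDeriv Ω c T u v) :
    HasDualDeriv Ω c T (r • u) (r • v) := by
  refine ⟨h.1.smul r, fun φ hφ => ?_⟩
  obtain ⟨h1, h2⟩ := h.2 φ hφ
  have e1 : (fun x => (r • u) x * T φ x) = fun x => r * (u x * T φ x) := by
    ext x
    simp [mul_assoc]
  have e2 : (fun x => (r • v) x * φ x) = fun x => r * (v x * φ x) := by
    ext x
    simp [mul_assoc]
  refine ⟨by rw [e1]; exact h1.const_mul r, ?_⟩
  rw [e1, e2, integral_const_mul, integral_const_mul, h2]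
  ring

theorem HasDualDeriv.zero : HasDualDeriv Ω c T 0 0 :=
  ⟨locallyIntegrable_zero.locallyIntegrableOn _, fun φ _ => by simp⟩

theorem HasDualDeriv.unique {u v v' : ℝ → ℝ} (h : HasDualDeriv Ω c T u v)
    (h' : HasDualDeriv Ω c T u v') : v =ᵐ[volume.restrict (Ω : Set ℝ)] v' := by
  have key := Ω.isOpen.ae_eq_zero_of_integral_contDiff_smul_eq_zero
    (μ := volume) (f := v - v') (h.1.sub h'.1) ?_
  · rw [Filter.EventuallyEq, ae_restrict_iff' Ω.isOpen.measurableSet]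
    filter_upwards [key] with x hx hxΩ
    exact sub_eq_zero.1 (hx hxΩ)
  · intro φ h1 h2 h3
    have hφ : IsTestFunction Ω φ := ⟨h1, h2, h3⟩
    have e : ∫ x in (Ω : Set ℝ), φ x • (v - v') x = ∫ x, φ x • (v - v') x := by
      refine setIntegral_eq_integral_of_forall_compl_eq_zero fun x hx => ?_
      rw [image_eq_zero_of_notMem_tsupport fun hx' => hx (h3 hx'), zero_smul]
    rw [← e]
    have e2 : (fun x => φ x • (v - v') x) = fun x => v x * φ x - v' x * φ x := by
      ext x
      simp only [Pi.sub_apply, smul_eq_mul]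
      ring
    rw [e2, integral_sub (hφ.integrable_mul h.1) (hφ.integrable_mul h'.1),
      (h.2 φ hφ).2, (h'.2 φ hφ).2, sub_self]

end DualDeriv

/-- The functions in `L^p(Ω)` that have a dual derivative in `L^p(Ω)`. -/
def dualDomain (p : ℝ≥0∞) [Fact (1 ≤ p)] (Ω : Opens ℝ) (c : ℝ) (T : (ℝ → ℝ) → ℝ → ℝ) :
    Submodule ℝ (LpOn p Ω) where
  carrier := {u | ∃ v : LpOn p Ω, HasDualDeriv Ω c T u v}
  add_mem' := by
    rintro u u' ⟨v, hv⟩ ⟨v', hv'⟩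
    exact ⟨v + v', (hv.add hv').congr (Lp.coeFn_add u u').symm (Lp.coeFn_add v v').symm
      (LpOn.locallyIntegrableOn Fact.out _)⟩
  zero_mem' := ⟨0, HasDualDeriv.zero.congr (Lp.coeFn_zero ..).symm (Lp.coeFn_zero ..).symm
    (LpOn.locallyIntegrableOn Fact.out _)⟩
  smul_mem' := by
    rintro r u ⟨v, hv⟩
    exact ⟨r • v, (hv.smul r).congr (Lp.coeFn_smul r u).symm (Lp.coeFn_smul r v).symm
      (LpOn.locallyIntegrableOn Fact.out _)⟩

/-- The (unique) dual derivative in `L^p(Ω)`. -/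
def dualDeriv (p : ℝ≥0∞) [Fact (1 ≤ p)] (Ω : Opens ℝ) (c : ℝ) (T : (ℝ → ℝ) → ℝ → ℝ) :
    dualDomain p Ω c T →ₗ[ℝ] LpOn p Ω where
  toFun u := u.2.choose
  map_add' u u' := by
    refine Lp.ext (HasDualDeriv.unique (c := c) (T := T) (u + u').2.choose_spec ?_)
    exact (u.2.choose_spec.add u'.2.choose_spec).congr (Lp.coeFn_add _ _).symm
      (Lp.coeFn_add _ _).symm (LpOn.locallyIntegrableOn Fact.out _)
  map_smul' r u := by
    refine Lp.ext (HasDualDeriv.unique (c := c) (T := T) (r • u).2.choose_spec ?_)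
    exact (u.2.choose_spec.smul r).congr (Lp.coeFn_smul _ _).symm
      (Lp.coeFn_smul _ _).symm (LpOn.locallyIntegrableOn Fact.out _)

/-- The set of `u ∈ W^{m,p}(Ω)`, `m = ⌊α⌋`, whose left / right weak fractional derivative of order
`α` exists and belongs to `L^p(Ω)`. -/
def fracSobolevSubmodule (s : Side) (α : ℝ) (p : ℝ≥0∞) [Fact (1 ≤ p)] (Ω : Opens ℝ) :
    Submodule ℝ (LpOn p Ω) :=
  (⨅ k : Fin (⌊α⌋₊ + 1), dualDomain p Ω ((-1) ^ (k : ℕ)) (fun φ => iteratedDeriv k φ)) ⊓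
    dualDomain p Ω ((-1) ^ ⌊α⌋₊) (fun φ => rlDeriv s.opp α φ)

theorem mem_fracSobolevSubmodule {s : Side} {α : ℝ} {p : ℝ≥0∞} [Fact (1 ≤ p)] {Ω : Opens ℝ}
    {u : LpOn p Ω} : u ∈ fracSobolevSubmodule s α p Ω ↔
      (∀ k : Fin (⌊α⌋₊ + 1), ∃ v : LpOn p Ω, HasWeakDeriv Ω k u v) ∧
        ∃ v : LpOn p Ω, HasWeakFracDeriv s α Ω u v := by
  simp only [fracSobolevSubmodule, Submodule.mem_inf, Submodule.mem_iInf]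
  rfl

/-- The left / right fractional Sobolev space of order `α` and exponent `p` on `Ω`, as a type of
its own because it does not carry the norm of `L^p(Ω)`. -/
def FracSobolev (s : Side) (α : ℝ) (p : ℝ≥0∞) [Fact (1 ≤ p)] (Ω : Opens ℝ) : Type :=
  fracSobolevSubmodule s α p Ω

namespace FracSobolev

variable {s : Side} {α : ℝ} {p : ℝ≥0∞} [Fact (1 ≤ p)] {Ω : Opens ℝ}

instance : AddCommGroup (FracSobolev s α p Ω) :=
  inferInstanceAs (AddCommGroup (fracSobolevSubmodule s α p Ω))

instance : Module ℝ (FracSobolev s α p Ω) :=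
  inferInstanceAs (Module ℝ (fracSobolevSubmodule s α p Ω))

/-- The underlying element of `L^p(Ω)`. -/
def toLp : FracSobolev s α p Ω →ₗ[ℝ] LpOn p Ω := (fracSobolevSubmodule s α p Ω).subtype

/-- The weak derivative of order `k ≤ ⌊α⌋`. -/
def weakDeriv (k : Fin (⌊α⌋₊ + 1)) : FracSobolev s α p Ω →ₗ[ℝ] LpOn p Ω :=
  dualDeriv p Ω ((-1) ^ (k : ℕ)) (fun φ => iteratedDeriv k φ) ∘ₗ
    Submodule.inclusion (inf_le_left.trans (iInf_le _ k))

/-- The left / right weak fractional derivative of order `α`. -/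
def weakFracDeriv : FracSobolev s α p Ω →ₗ[ℝ] LpOn p Ω :=
  dualDeriv p Ω ((-1) ^ ⌊α⌋₊) (fun φ => rlDeriv s.opp α φ) ∘ₗ Submodule.inclusion inf_le_right

theorem hasWeakDeriv (k : Fin (⌊α⌋₊ + 1)) (u : FracSobolev s α p Ω) :
    HasWeakDeriv Ω k (toLp u) (weakDeriv k u) :=
  (Submodule.inclusion (inf_le_left.trans (iInf_le _ k)) u :
    dualDomain p Ω ((-1) ^ (k : ℕ)) (fun φ => iteratedDeriv k φ)).2.choose_spec

theorem hasWeakFracDeriv (u : FracSobolev s α p Ω) :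
    HasWeakFracDeriv s α Ω (toLp u) (weakFracDeriv u) :=
  (Submodule.inclusion inf_le_right u :
    dualDomain p Ω ((-1) ^ ⌊α⌋₊) (fun φ => rlDeriv s.opp α φ)).2.choose_spec

theorem weakDeriv_zero_order (u : FracSobolev s α p Ω) : weakDeriv 0 u = toLp u := by
  refine Lp.ext ((hasWeakDeriv 0 u).unique
    ⟨LpOn.locallyIntegrableOn Fact.out _, fun φ hφ => ⟨?_, ?_⟩⟩)
  · simpa using hφ.integrable_mul (LpOn.locallyIntegrableOn Fact.out (toLp u))
  · simp

/-- All derivatives of `u` that enter the norm. -/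
def jet : FracSobolev s α p Ω →ₗ[ℝ]
    WithLp p (PiLp p (fun _ : Fin (⌊α⌋₊ + 1) => LpOn p Ω) × LpOn p Ω) where
  toFun u := WithLp.toLp p (WithLp.toLp p (fun k => weakDeriv k u), weakFracDeriv u)
  map_add' u v := by
    simp only [map_add]
    rfl
  map_smul' r u := by
    simp only [map_smul]
    rfl

theorem jet_injective : Function.Injective (jet (s := s) (α := α) (p := p) (Ω := Ω)) := by
  intro u v h
  have h0 : weakDeriv 0 u = weakDeriv 0 v :=
    congrArg (fun w => (WithLp.ofLp (WithLp.ofLp w).1) 0) h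
  rw [weakDeriv_zero_order, weakDeriv_zero_order] at h0
  exact Subtype.ext h0

/-- The norm `(‖u‖_{W^{m,p}}^p + ‖D^α u‖_{L^p}^p)^(1/p)`; see `norm_eq` for the formula. -/
instance : NormedAddCommGroup (FracSobolev s α p Ω) :=
  NormedAddCommGroup.induced _ _ jet jet_injective

instance : NormedSpace ℝ (FracSobolev s α p Ω) :=
  NormedSpace.induced ℝ _ _ jet

theorem norm_eq (hp : p ≠ ⊤) (u : FracSobolev s α p Ω) :
    ‖u‖ = ((∑ k : Fin (⌊α⌋₊ + 1), ‖weakDeriv k u‖ ^ p.toReal) +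
      ‖weakFracDeriv u‖ ^ p.toReal) ^ (1 / p.toReal) := by
  have h1 : (1 : ℝ≥0∞) ≤ p := Fact.out
  have hp0 : 0 < p.toReal := ENNReal.toReal_pos (zero_lt_one.trans_le h1).ne' hp
  change ‖jet u‖ = _
  rw [WithLp.prod_norm_eq_add hp0, PiLp.norm_eq_sum hp0, ← Real.rpow_mul
    (Finset.sum_nonneg fun _ _ => Real.rpow_nonneg (norm_nonneg _) _),
    one_div_mul_cancel hp0.ne', Real.rpow_one]
  rfl

/-- The functions in the fractional Sobolev space that belong to `C^∞(Ω)`, that is, the functions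
in `C^∞(Ω)` whose fractional Sobolev norm is defined and finite. -/
def smoothPart (s : Side) (α : ℝ) (p : ℝ≥0∞) [Fact (1 ≤ p)] (Ω : Opens ℝ) :
    Submodule ℝ (FracSobolev s α p Ω) where
  carrier := {u | ∃ f : ℝ → ℝ, ContDiffOn ℝ ∞ f Ω ∧
    (toLp u : ℝ → ℝ) =ᵐ[volume.restrict (Ω : Set ℝ)] f}
  add_mem' := by
    rintro u v ⟨f, hf, hu⟩ ⟨g, hg, hv⟩
    refine ⟨f + g, hf.add hg, ?_⟩
    rw [map_add]
    exact (Lp.coeFn_add _ _).trans (hu.add hv)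
  zero_mem' := ⟨0, contDiffOn_const, by rw [map_zero]; exact Lp.coeFn_zero ..⟩
  smul_mem' := by
    rintro r u ⟨f, hf, hu⟩
    refine ⟨r • f, contDiffOn_const.smul hf, ?_⟩
    rw [map_smul]
    exact (Lp.coeFn_smul _ _).trans (hu.const_smul r)

end FracSobolev

/-- The completion of `C^∞(Ω)` in the norm of the fractional Sobolev space. -/
abbrev CompletedFracSobolev (s : Side) (α : ℝ) (p : ℝ≥0∞) [Fact (1 ≤ p)] (Ω : Opens ℝ) : Type :=
  UniformSpace.Completion (FracSobolev.smoothPart s α p Ω)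

end

/-! Write `I^β` for the fractional integral in the chosen direction, m = ⌊α⌋ and σ = m + 1 - α ∈ (0,
1]. Once density of the smooth functions is known, the isometry is formal: the space is complete
because weak derivatives are closed under `L^p` limits (`FracSobolev.completeSpace`), and the
completion of a dense subspace of a Banach space is that space.

On the line, convolution with a mollifier commutes with every translation invariant weak derivative
(`HasDualDeriv.lpConv`), so mollification converges in all terms of the norm at once. Pairings
converge absolutely because fractional derivatives of test functions lie in every `L^q`
(`memAllLp_rlDeriv`).

On a bounded interval the fractional derivative is nonlocal and cutoffs are of no use. Instead the
weak derivative D^α is studied as a map to `L^p(Ω)`. It is onto, already from the closure of the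
smooth functions: for a test function v, a multiple of `I^α v` is smooth with D^α equal to v, its
derivatives of order k ≤ m are multiples of `I^(α-k) v`, bounded in `L^p` by v, and test functions
are dense (`FracSobolev.exists_mem_closure_weakFracDeriv_eq`). Its kernel consists of smooth
functions: D^α f = 0 makes `I^σ f` a polynomial by du Bois-Reymond; applying `I^(1-σ)` if σ < 1
shows that `I^1 f` is smooth in Ω, and f is its derivative up to sign
(`exists_contDiffOn_of_weakFracDeriv_eq_zero`). Hence any u is U + (u - U) with U in the closure,
D^α U = D^α u and u - U smooth.

Both directions are treated together through a sign e = ±1, with Ω written as c < e x < d, so that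
integration always starts at the end e x = c. -/

noncomputable section

set_option linter.unusedSectionVars false
set_option autoImplicit false

open Filter Topology Convolution

/-! ### Pairings, translations and convolution on `L^p` -/

section LpTools

variable {p : ℝ≥0∞} [Fact (1 ≤ p)] {μ : Measure ℝ}

/-- `g` belongs to every space `L^q(μ)`. -/
def MemAllLp (g : ℝ → ℝ) (μ : Measure ℝ) : Prop := ∀ q : ℝ≥0∞, 1 ≤ q → MemLp g q μ

/-- The bound |g|^q ≤ C^(q-1) |g| interpolates between `L^1` and `L^∞`. -/
theorem MemAllLp.of_integrable_of_bound {g : ℝ → ℝ} (hg : Integrable g μ) {C : ℝ}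
    (hC : ∀ x, ‖g x‖ ≤ C) : MemAllLp g μ := by
  intro q hq
  have h1 : MemLp g 1 μ := memLp_one_iff_integrable.2 hg
  have h2 : MemLp g ⊤ μ := memLp_top_of_bound hg.1 C (Eventually.of_forall hC)
  by_cases hq' : q = ⊤
  · exact hq' ▸ h2
  · refine ⟨hg.1, ?_⟩
    have hqp : 0 < q.toReal := ENNReal.toReal_pos (zero_lt_one.trans_le hq).ne' hq'
    rw [eLpNorm_lt_top_iff_lintegral_rpow_enorm_lt_top (zero_lt_one.trans_le hq).ne' hq']
    have hq1 : 1 ≤ q.toReal := by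
      simpa using ENNReal.toReal_mono hq' hq
    calc ∫⁻ x, ‖g x‖ₑ ^ q.toReal ∂μ
        ≤ ∫⁻ x, (ENNReal.ofReal C) ^ (q.toReal - 1) * ‖g x‖ₑ ∂μ := by
          refine lintegral_mono fun x => ?_
          have : ‖g x‖ₑ ^ q.toReal = ‖g x‖ₑ ^ (q.toReal - 1) * ‖g x‖ₑ := by
            conv_lhs => rw [← sub_add_cancel q.toReal 1]
            rw [ENNReal.rpow_add_of_nonneg _ _ (by linarith) zero_le_one, ENNReal.rpow_one]
          rw [this]
          gcongr
          rw [← ofReal_norm]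
          exact ENNReal.ofReal_le_ofReal (hC x)
      _ = (ENNReal.ofReal C) ^ (q.toReal - 1) * ∫⁻ x, ‖g x‖ₑ ∂μ :=
          lintegral_const_mul' _ _
            (ENNReal.rpow_ne_top_of_nonneg (by linarith) ENNReal.ofReal_ne_top)
      _ < ⊤ := ENNReal.mul_lt_top
          (ENNReal.rpow_lt_top_of_nonneg (by linarith) ENNReal.ofReal_ne_top) hg.2

theorem MemAllLp.of_hasCompactSupport [IsLocallyFiniteMeasure μ] {g : ℝ → ℝ} (hg : Continuous g)
    (hc : HasCompactSupport g) : MemAllLp g μ :=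
  fun _ _ => hg.memLp_of_hasCompactSupport hc

theorem MemAllLp.restrict {g : ℝ → ℝ} (hg : MemAllLp g μ) (s : Set ℝ) :
    MemAllLp g (μ.restrict s) := fun q hq => (hg q hq).restrict s

theorem MemAllLp.integrable_mul {g f : ℝ → ℝ} (hg : MemAllLp g μ) (hf : MemLp f p μ) :
    Integrable (fun x => f x * g x) μ := by
  have : ENNReal.HolderConjugate p (ENNReal.conjExponent p) :=
    ENNReal.HolderConjugate.conjExponent Fact.out
  have hc : 1 ≤ ENNReal.conjExponent p := ENNReal.HolderConjugate.one_le _ p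
  exact hf.integrable_mul (hg _ hc)

/-- Having the pairing as a continuous functional lets `L^p` limits and `L^p`-valued integrals pass
through weak identities. -/
theorem MemAllLp.exists_pairing {g : ℝ → ℝ} (hg : MemAllLp g μ) :
    ∃ L : Lp ℝ p μ →L[ℝ] ℝ, ∀ f : Lp ℝ p μ, L f = ∫ x, f x * g x ∂μ := by
  have : ENNReal.HolderConjugate p (ENNReal.conjExponent p) :=
    ENNReal.HolderConjugate.conjExponent Fact.out
  have hc : 1 ≤ ENNReal.conjExponent p := ENNReal.HolderConjugate.one_le _ p
  have : Fact (1 ≤ ENNReal.conjExponent p) := ⟨hc⟩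
  refine ⟨(ContinuousLinearMap.lpPairing μ p (ENNReal.conjExponent p)
    (ContinuousLinearMap.mul ℝ ℝ)).flip ((hg _ hc).toLp g), fun f => ?_⟩
  rw [ContinuousLinearMap.flip_apply, ContinuousLinearMap.lpPairing_eq_integral]
  refine integral_congr_ae ?_
  filter_upwards [(hg _ hc).coeFn_toLp] with x hx
  simp [hx]

/-- The translation `f ↦ f (· - y)` of `L^p(ℝ)`. -/
def lpShift (p : ℝ≥0∞) [Fact (1 ≤ p)] (y : ℝ) :
    Lp ℝ p (volume : Measure ℝ) →ₗᵢ[ℝ] Lp ℝ p (volume : Measure ℝ) :=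
  Lp.compMeasurePreservingₗᵢ ℝ (fun x => x - y) (measurePreserving_sub_right volume y)

theorem coeFn_lpShift (y : ℝ) (f : Lp ℝ p (volume : Measure ℝ)) :
    lpShift p y f =ᵐ[volume] fun x => f (x - y) :=
  Lp.coeFn_compMeasurePreserving f (measurePreserving_sub_right volume y)

/-- Finiteness of the exponent is essential: translations are not strongly continuous on `L^∞`. -/
theorem continuous_lpShift (hp : p ≠ ⊤) (f : Lp ℝ p (volume : Measure ℝ)) :
    Continuous fun y => lpShift p y f := by
  let g : ℝ → C(ℝ, ℝ) := fun y => ⟨fun x => x - y, by fun_prop⟩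
  have hg : Continuous g := by
    let G : C(ℝ × ℝ, ℝ) := ⟨fun z => z.2 - z.1, by fun_prop⟩
    exact G.curry.continuous
  exact (continuous_const (y := f)).compMeasurePreservingLp hg
    (fun y => measurePreserving_sub_right volume y) hp

theorem lpShift_zero (f : Lp ℝ p (volume : Measure ℝ)) : lpShift p 0 f = f := by
  refine Lp.ext ((coeFn_lpShift 0 f).trans ?_)
  simp

/-- Convolution with an integrable function `k` on `L^p(ℝ)`, as a Bochner integral in `L^p`. -/
def lpConv (k : ℝ → ℝ) (f : Lp ℝ p (volume : Measure ℝ)) : Lp ℝ p (volume : Measure ℝ) :=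
  ∫ y, k y • lpShift p y f

theorem integrable_smul_lpShift (hp : p ≠ ⊤) {k : ℝ → ℝ} (hk : Integrable k)
    (f : Lp ℝ p (volume : Measure ℝ)) : Integrable fun y => k y • lpShift p y f := by
  refine (hk.norm.mul_const ‖f‖).mono' ?_ ?_
  · exact hk.1.smul (continuous_lpShift hp f).aestronglyMeasurable
  · refine Eventually.of_forall fun y => ?_
    rw [norm_smul, (lpShift p y).norm_map]

theorem norm_lpConv_le {k : ℝ → ℝ} (f : Lp ℝ p (volume : Measure ℝ)) :
    ‖lpConv k f‖ ≤ (∫ y, ‖k y‖) * ‖f‖ := by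
  refine (norm_integral_le_integral_norm _).trans_eq ?_
  simp_rw [norm_smul, (lpShift p _).norm_map]
  exact integral_mul_const _ _

theorem map_lpConv (hp : p ≠ ⊤) {k : ℝ → ℝ} (hk : Integrable k)
    (f : Lp ℝ p (volume : Measure ℝ)) (L : Lp ℝ p (volume : Measure ℝ) →L[ℝ] ℝ) :
    L (lpConv k f) = ∫ y, k y * L (lpShift p y f) := by
  rw [lpConv, ← L.integral_comp_comm (integrable_smul_lpShift hp hk f)]
  simp

/-- The hypothesis of Fubini for all convolution identities: by Hölder the inner integral over x is
at most a constant times |k y|, uniformly in the shift, since shifts preserve the norm. -/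
theorem integrable_conv_pairing {k : ℝ → ℝ} (hk : Integrable k) {f g : ℝ → ℝ}
    (hf : MemLp f p volume) (hg : MemAllLp g volume) :
    Integrable (fun z : ℝ × ℝ => k z.2 * f (z.1 - z.2) * g z.1) (volume.prod volume) := by
  have h_meas : AEStronglyMeasurable (fun z : ℝ × ℝ => k z.2 * f (z.1 - z.2) * g z.1)
      (volume.prod volume) :=
    (hk.1.convolution_integrand (ContinuousLinearMap.mul ℝ ℝ) hf.1).mul (hg 1 le_rfl).1.comp_fst
  have hfy : ∀ y, MemLp (fun x => f (x - y)) p volume := fun y =>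
    hf.comp_measurePreserving (measurePreserving_sub_right volume y)
  rw [integrable_prod_iff' h_meas]
  refine ⟨Eventually.of_forall fun y => ?_, ?_⟩
  · simp_rw [mul_assoc]
    exact (hg.integrable_mul (hfy y)).const_mul _
  · have : ENNReal.HolderConjugate p (ENNReal.conjExponent p) :=
      ENNReal.HolderConjugate.conjExponent Fact.out
    have hc : 1 ≤ ENNReal.conjExponent p := ENNReal.HolderConjugate.one_le _ p
    have hgn : MemAllLp (fun x => ‖g x‖) volume := fun q hq => (hg q hq).norm
    obtain ⟨L, hL⟩ := hgn.exists_pairing (p := p)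
    refine (hk.norm.mul_const (‖L‖ * ‖hf.norm.toLp _‖)).mono'
      h_meas.prod_swap.norm.integral_prod_right' (Eventually.of_forall fun y => ?_)
    rw [Real.norm_of_nonneg (integral_nonneg fun _ => norm_nonneg _)]
    simp_rw [norm_mul, mul_assoc]
    rw [integral_const_mul]
    gcongr
    have e : ∫ x, ‖f (x - y)‖ * ‖g x‖ = L (lpShift p y (hf.norm.toLp _)) := by
      rw [hL]
      refine integral_congr_ae ?_
      have h2 := (measurePreserving_sub_right volume y).quasiMeasurePreserving.ae
        hf.norm.coeFn_toLp
      filter_upwards [coeFn_lpShift y (hf.norm.toLp _), h2] with x h1 h2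
      rw [h1, h2]
    rw [e]
    refine (le_abs_self _).trans ((L.le_opNorm _).trans_eq ?_)
    rw [(lpShift p y).norm_map]

/-- Links the vector-valued integral to the pointwise one: both are locally integrable and agree
against test functions by Fubini. -/
theorem coeFn_lpConv (hp : p ≠ ⊤) {k : ℝ → ℝ} (hk : Integrable k)
    (f : Lp ℝ p (volume : Measure ℝ)) :
    lpConv k f =ᵐ[volume] fun x => ∫ y, k y * f (x - y) := by
  have hint := fun (g : ℝ → ℝ) (hg : MemAllLp g volume) =>
    integrable_conv_pairing hk (Lp.memLp f) hg
  have hloc : LocallyIntegrable (fun x => ∫ y, k y * f (x - y)) volume := by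
    rw [locallyIntegrable_iff]
    intro s hs
    -- Pairing with the indicator of a compact set turns joint integrability into local
    -- integrability.
    have hg : MemAllLp (s.indicator fun _ => (1 : ℝ)) volume := fun q hq =>
      memLp_indicator_const q hs.measurableSet 1 (Or.inr hs.measure_lt_top.ne)
    have h := (hint _ hg).integral_prod_left
    rw [← integrable_indicator_iff hs.measurableSet]
    refine h.congr (Eventually.of_forall fun x => ?_)
    simp only [integral_mul_const]
    by_cases hx : x ∈ s <;> simp [hx]
  refine ae_eq_of_integral_contDiff_smul_eq ((Lp.memLp _).locallyIntegrable Fact.out) hloc ?_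
  intro g hg hgc
  have hga : MemAllLp g volume := .of_hasCompactSupport hg.continuous hgc
  obtain ⟨L, hL⟩ := hga.exists_pairing (p := p)
  have e1 : ∫ x, g x • lpConv k f x = L (lpConv k f) := by
    rw [hL]; simp [mul_comm]
  rw [e1, map_lpConv hp hk]
  have e2 : ∀ y, k y * L (lpShift p y f) = ∫ x, k y * f (x - y) * g x := by
    intro y
    rw [hL, ← integral_const_mul]
    refine integral_congr_ae ?_
    filter_upwards [coeFn_lpShift y f] with x hx
    rw [hx, mul_assoc]
  simp_rw [e2]
  rw [← integral_integral_swap (hint g hga)]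
  refine integral_congr_ae (Eventually.of_forall fun x => ?_)
  simp only [integral_mul_const, smul_eq_mul]
  ring

theorem tendsto_lpConv {ι : Type*} {l : Filter ι} (hp : p ≠ ⊤) {k : ι → ContDiffBump (0 : ℝ)}
    (hk : Tendsto (fun i => (k i).rOut) l (𝓝 0)) (f : Lp ℝ p (volume : Measure ℝ)) :
    Tendsto (fun i => lpConv ((k i).normed volume) f) l (𝓝 f) := by
  rw [Metric.tendsto_nhds]
  intro ε hε
  have hc := (continuous_lpShift hp f).tendsto 0
  rw [lpShift_zero, Metric.tendsto_nhds] at hc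
  obtain ⟨δ, hδ, hδ'⟩ := Metric.eventually_nhds_iff.1 (hc (ε / 2) (by positivity))
  filter_upwards [hk.eventually (gt_mem_nhds hδ)] with i hi
  have hki : Integrable ((k i).normed volume) := (k i).integrable_normed
  have e : f = ∫ y, (k i).normed volume y • f := by
    rw [integral_smul_const, (k i).integral_normed, one_smul]
  have e' : lpConv ((k i).normed volume) f - f =
      ∫ y, (k i).normed volume y • (lpShift p y f - f) := by
    simp_rw [smul_sub]
    rw [integral_sub (integrable_smul_lpShift hp hki f) (hki.smul_const f), ← e]
    rfl
  rw [dist_eq_norm, e']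
  -- On the support of the bump the shift moves f by at most ε/2; elsewhere the kernel vanishes.
  refine (norm_integral_le_of_norm_le (hki.mul_const (ε / 2)) (Eventually.of_forall fun y => ?_)
    ).trans_lt ?_
  · rw [norm_smul, Real.norm_of_nonneg ((k i).nonneg_normed y)]
    by_cases hy : y ∈ Metric.ball (0 : ℝ) (k i).rOut
    · gcongr
      · exact (k i).nonneg_normed y
      · rw [← dist_eq_norm]
        exact (hδ' (lt_trans hy hi)).le
    · have : (k i).normed volume y = 0 := by
        rw [← Function.notMem_support, (k i).support_normed_eq]
        exact hy
      simp [this]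
  · rw [integral_mul_const, (k i).integral_normed]
    linarith

end LpTools

/-! ### One-sided power kernels and their semigroup law -/

section PowKernel

/-- The one-sided power kernel `t ↦ t₊^(β - 1)`, reflected if `e = -1`. -/
def powKernel (e β t : ℝ) : ℝ := if 0 < e * t then (e * t) ^ (β - 1) else 0

variable {e β σ τ : ℝ}

theorem powKernel_nonneg (e β t : ℝ) : 0 ≤ powKernel e β t := by
  unfold powKernel
  split_ifs with h
  · exact Real.rpow_nonneg h.le _
  · exact le_rfl

theorem powKernel_neg (e β t : ℝ) : powKernel (-e) β t = powKernel e β (-t) := by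
  simp [powKernel]

theorem powKernel_of_pos {t : ℝ} (h : 0 < e * t) : powKernel e β t = (e * t) ^ (β - 1) :=
  if_pos h

theorem powKernel_of_nonpos {t : ℝ} (h : e * t ≤ 0) : powKernel e β t = 0 :=
  if_neg h.not_gt

theorem powKernel_mul {x : ℝ} (hx : 0 < e * x) (s : ℝ) :
    powKernel e β (x * s) = (e * x) ^ (β - 1) * powKernel 1 β s := by
  by_cases hs : 0 < s
  · rw [powKernel_of_pos (by rw [← mul_assoc]; positivity), powKernel_of_pos (by simpa),
      ← mul_assoc, Real.mul_rpow hx.le hs.le, one_mul]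
  · have h : e * (x * s) ≤ 0 := by
      rw [← mul_assoc]
      exact mul_nonpos_of_nonneg_of_nonpos hx.le (not_lt.1 hs)
    rw [powKernel_of_nonpos h, powKernel_of_nonpos (by simpa using hs), mul_zero]

theorem measurable_powKernel (e β : ℝ) : Measurable (powKernel e β) := by
  unfold powKernel
  exact Measurable.ite (measurableSet_lt measurable_const (by fun_prop)) (by fun_prop) (by fun_prop)

theorem locallyIntegrable_powKernel (he : e = 1 ∨ e = -1) (hβ : 0 < β) :
    LocallyIntegrable (powKernel e β) volume := by
  have h1 : LocallyIntegrable (powKernel 1 β) volume := by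
    intro x
    refine ⟨Ioo (x - 1) (x + 1), Ioo_mem_nhds (by linarith) (by linarith), ?_⟩
    have h := (intervalIntegral.intervalIntegrable_rpow' (a := x - 1) (b := x + 1) (r := β - 1)
      (by linarith)).1.mono_set (Ioo_subset_Ioc_self)
    refine (h.indicator (measurableSet_Ioi (a := (0 : ℝ)))).congr ?_
    refine Eventually.of_forall fun t => ?_
    simp [powKernel, indicator_apply]
  rcases he with rfl | rfl
  · exact h1
  · intro x
    obtain ⟨s, hs, hs'⟩ := h1 (-x)
    refine ⟨-s, ?_, ?_⟩
    · exact (continuous_neg.tendsto x) hs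
    · have e1 : powKernel (-1) β = fun t => powKernel 1 β (-t) :=
        funext fun t => powKernel_neg 1 β t
      rw [e1]
      exact (Measure.measurePreserving_neg volume).integrableOn_comp_preimage
        (Homeomorph.neg ℝ).measurableEmbedding |>.2 hs'

theorem integrable_powKernel_mul_powKernel_one (hσ : 0 < σ) (hτ : 0 < τ) :
    Integrable fun t => powKernel 1 σ t * powKernel 1 τ (1 - t) := by
  have h := Complex.betaIntegral_convergent (u := σ) (v := τ) (by simpa) (by simpa)
  rw [intervalIntegrable_iff_integrableOn_Ioc_of_le zero_le_one,
    integrableOn_Ioc_iff_integrableOn_Ioo] at h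
  have h2 : IntegrableOn _ (Ioo (0 : ℝ) 1) := h.norm
  rw [← integrable_indicator_iff measurableSet_Ioo] at h2
  refine h2.congr (Eventually.of_forall fun t => ?_)
  beta_reduce
  by_cases ht : t ∈ Ioo (0 : ℝ) 1
  · rw [indicator_of_mem ht, powKernel_of_pos (by simpa using ht.1),
      powKernel_of_pos (by simpa using ht.2), norm_mul]
    congr 1
    · rw [Complex.norm_cpow_eq_rpow_re_of_pos ht.1]
      simp
    · have : (1 - t : ℂ) = ((1 - t : ℝ) : ℂ) := by simp
      rw [this, Complex.norm_cpow_eq_rpow_re_of_pos (by linarith [ht.2])]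
      simp
  · rw [indicator_of_notMem ht]
    by_cases h0 : 0 < t
    · rw [powKernel_of_nonpos (t := 1 - t) (by
        have : 1 ≤ t := not_lt.1 fun h1 => ht ⟨h0, h1⟩
        linarith), mul_zero]
    · rw [powKernel_of_nonpos (by simpa using h0), zero_mul]

/-- The value of Euler's beta integral. -/
def betaConst (σ τ : ℝ) : ℝ := ∫ t, powKernel 1 σ t * powKernel 1 τ (1 - t)

/-- Positivity is all that is needed about this constant; its expression by Gamma values plays no
role. -/
theorem betaConst_pos (hσ : 0 < σ) (hτ : 0 < τ) : 0 < betaConst σ τ := by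
  unfold betaConst
  rw [integral_pos_iff_support_of_nonneg
    (fun t => mul_nonneg (powKernel_nonneg _ _ _) (powKernel_nonneg _ _ _))
    (integrable_powKernel_mul_powKernel_one hσ hτ)]
  refine lt_of_lt_of_le (b := volume (Ioo (0 : ℝ) 1)) (by simp) (measure_mono fun t ht => ?_)
  rw [Function.mem_support, powKernel_of_pos (by simpa using ht.1),
    powKernel_of_pos (by simpa using ht.2)]
  have h1 : 0 < 1 * t := by simpa using ht.1
  have h2 : 0 < 1 * (1 - t) := by simpa using ht.2
  positivity

theorem powKernel_mul_powKernel_of_nonpos {x : ℝ} (hx : e * x ≤ 0) (t : ℝ) :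
    powKernel e σ t * powKernel e τ (x - t) = 0 := by
  by_cases h : 0 < e * t
  · rw [powKernel_of_nonpos (t := x - t) (by rw [mul_sub]; linarith), mul_zero]
  · rw [powKernel_of_nonpos (not_lt.1 h), zero_mul]

theorem powKernel_mul_powKernel_scale {x : ℝ} (hx : 0 < e * x) (s : ℝ) :
    powKernel e σ (x * s) * powKernel e τ (x - x * s) =
      (e * x) ^ (σ + τ - 2) * (powKernel 1 σ s * powKernel 1 τ (1 - s)) := by
  rw [show x - x * s = x * (1 - s) by ring, powKernel_mul hx, powKernel_mul hx,
    show σ + τ - 2 = (σ - 1) + (τ - 1) by ring, Real.rpow_add hx]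
  ring

theorem integrable_powKernel_mul_powKernel (hσ : 0 < σ) (hτ : 0 < τ) (x : ℝ) :
    Integrable fun t => powKernel e σ t * powKernel e τ (x - t) := by
  by_cases hx : 0 < e * x
  · have hx0 : x ≠ 0 := by rintro rfl; simp at hx
    rw [← integrable_comp_mul_left_iff _ hx0]
    simp_rw [powKernel_mul_powKernel_scale hx]
    exact (integrable_powKernel_mul_powKernel_one hσ hτ).const_mul _
  · simp_rw [powKernel_mul_powKernel_of_nonpos (not_lt.1 hx)]
    exact integrable_zero _ _ _

/-- The substitution t = x s reduces to x = 1: the integrand is homogeneous of degree σ + τ - 2 and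
the Jacobian |x| = e x adds one. -/
theorem integral_powKernel_mul_powKernel (he : e = 1 ∨ e = -1) (x : ℝ) :
    ∫ t, powKernel e σ t * powKernel e τ (x - t) = betaConst σ τ * powKernel e (σ + τ) x := by
  by_cases hx : 0 < e * x
  · have hx0 : x ≠ 0 := by rintro rfl; simp at hx
    have h := Measure.integral_comp_mul_left
      (fun t => powKernel e σ t * powKernel e τ (x - t)) x
    simp_rw [powKernel_mul_powKernel_scale hx] at h
    rw [integral_const_mul] at h
    have hxe : |x| = e * x := by
      rcases he with rfl | rfl
      · rw [abs_of_pos (by linarith)]; ring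
      · rw [abs_of_neg (by linarith)]; ring
    rw [abs_inv, hxe, smul_eq_mul, eq_inv_mul_iff_mul_eq₀ hx.ne'] at h
    rw [← h, powKernel_of_pos hx, ← betaConst, show σ + τ - 1 = 1 + (σ + τ - 2) by ring,
      Real.rpow_add hx, Real.rpow_one]
    ring
  · simp_rw [powKernel_mul_powKernel_of_nonpos (not_lt.1 hx)]
    rw [powKernel_of_nonpos (not_lt.1 hx)]
    simp

/-- Convolution with the one-sided power kernel. -/
def powConv (e β : ℝ) (f : ℝ → ℝ) : ℝ → ℝ :=
  powKernel e β ⋆[ContinuousLinearMap.mul ℝ ℝ, volume] f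

theorem powConv_apply (e β : ℝ) (f : ℝ → ℝ) (x : ℝ) :
    powConv e β f x = ∫ t, powKernel e β t * f (x - t) := rfl

theorem powConv_const_mul (e β c : ℝ) (f : ℝ → ℝ) :
    powConv e β (fun x => c * f x) = fun x => c * powConv e β f x := by
  ext x
  simp_rw [powConv_apply, ← integral_const_mul]
  congr with t
  ring

theorem contDiff_powConv (he : e = 1 ∨ e = -1) (hβ : 0 < β) {f : ℝ → ℝ} (hf : ContDiff ℝ ∞ f)
    (hc : HasCompactSupport f) : ContDiff ℝ ∞ (powConv e β f) :=
  hc.contDiff_convolution_right _ (locallyIntegrable_powKernel he hβ) hf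

theorem deriv_powConv (he : e = 1 ∨ e = -1) (hβ : 0 < β) {f : ℝ → ℝ} (hf : ContDiff ℝ ∞ f)
    (hc : HasCompactSupport f) : deriv (powConv e β f) = powConv e β (deriv f) := by
  ext x
  exact (hc.hasDerivAt_convolution_right (ContinuousLinearMap.mul ℝ ℝ)
    (locallyIntegrable_powKernel he hβ) (hf.of_le (by simp)) x).deriv

theorem iteratedDeriv_powConv (he : e = 1 ∨ e = -1) (hβ : 0 < β) {f : ℝ → ℝ}
    (hf : ContDiff ℝ ∞ f) (hc : HasCompactSupport f) (k : ℕ) :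
    iteratedDeriv k (powConv e β f) = powConv e β (iteratedDeriv k f) := by
  induction k generalizing f with
  | zero => simp
  | succ k ih =>
    rw [iteratedDeriv_succ', iteratedDeriv_succ', deriv_powConv he hβ hf hc,
      ih (f := deriv f) (hf.iterate_deriv 1) hc.deriv]

theorem convolutionExists_powKernel (he : e = 1 ∨ e = -1) (hβ : 0 < β) {f : ℝ → ℝ}
    (hf : Continuous f) (hc : HasCompactSupport f) :
    ConvolutionExists (powKernel e β) f (ContinuousLinearMap.mul ℝ ℝ) volume :=
  hc.convolutionExists_right _ (locallyIntegrable_powKernel he hβ) hf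

/-- Causality: the value at x only involves points x - t with e t > 0. -/
theorem powConv_eq_zero {c : ℝ} {f : ℝ → ℝ} (hf : ∀ x, e * x < c → f x = 0) {x : ℝ}
    (hx : e * x < c) : powConv e β f x = 0 := by
  rw [powConv_apply]
  refine integral_eq_zero_of_ae (Eventually.of_forall fun t => ?_)
  by_cases h : 0 < e * t
  · simp [hf (x - t) (by rw [mul_sub]; linarith)]
  · simp [powKernel_of_nonpos (not_lt.1 h)]

/-- Semigroup property of the fractional integrals on compactly supported functions. -/
theorem powConv_powConv (he : e = 1 ∨ e = -1) (hσ : 0 < σ) (hτ : 0 < τ) {f : ℝ → ℝ}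
    (hf : Continuous f) (hc : HasCompactSupport f) :
    powConv e σ (powConv e τ f) = fun x => betaConst σ τ * powConv e (σ + τ) f x := by
  have hcn : HasCompactSupport fun x => ‖f x‖ := hc.norm
  have hn : ∀ β : ℝ, (fun x => ‖powKernel e β x‖) = powKernel e β := fun β =>
    funext fun x => Real.norm_of_nonneg (powKernel_nonneg e β x)
  ext x
  have h := convolution_assoc (ContinuousLinearMap.mul ℝ ℝ) (ContinuousLinearMap.mul ℝ ℝ)
    (ContinuousLinearMap.mul ℝ ℝ) (ContinuousLinearMap.mul ℝ ℝ) (f := powKernel e σ)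
    (g := powKernel e τ) (k := f) (μ := volume) (ν := volume) (x₀ := x)
    (fun a b c => by simp [mul_assoc]) (measurable_powKernel e σ).aestronglyMeasurable
    (measurable_powKernel e τ).aestronglyMeasurable hf.aestronglyMeasurable
    (Eventually.of_forall fun y => integrable_powKernel_mul_powKernel hσ hτ y)
    (Eventually.of_forall fun y => by
      rw [hn]; exact convolutionExists_powKernel he hτ hf.norm hcn y) ?_
  · refine Eq.trans h.symm ?_
    have e1 : powKernel e σ ⋆[ContinuousLinearMap.mul ℝ ℝ, volume] powKernel e τ =
        betaConst σ τ • powKernel e (σ + τ) :=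
      funext fun y => integral_powKernel_mul_powKernel he y
    rw [e1, smul_convolution]
    rfl
  · rw [hn, hn]
    have hcont : Continuous (powConv e τ fun x => ‖f x‖) :=
      hcn.continuous_convolution_right _ (locallyIntegrable_powKernel he hτ) hf.norm
    -- The inner convolution is not compactly supported, but it vanishes for e y < -R, while the
    -- outer kernel vanishes for e t ≤ 0. So the product is compactly supported in t.
    refine HasCompactSupport.convolutionExistsAt _ ?_ (locallyIntegrable_powKernel he hσ) hcont
    obtain ⟨R, hR⟩ := hc.isCompact.isBounded.subset_closedBall 0
    have hz : ∀ y, e * y < -R → powConv e τ (fun x => ‖f x‖) y = 0 := fun y hy => by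
      refine powConv_eq_zero (c := -R) (fun z hz => ?_) hy
      rw [norm_eq_zero]
      refine image_eq_zero_of_notMem_tsupport fun h' => ?_
      have := hR h'
      rw [mem_closedBall_zero_iff, Real.norm_eq_abs, abs_le] at this
      rcases he with rfl | rfl <;> linarith
    refine HasCompactSupport.intro (isCompact_closedBall (0 : ℝ) (|x| + R)) fun t ht => ?_
    rw [mem_closedBall_zero_iff, not_le, Real.norm_eq_abs] at ht
    have hxa := abs_le.1 (le_refl |x|)
    by_cases h0 : 0 < e * t
    · have : e * (x - t) < -R := by
        rcases he with rfl | rfl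
        · rw [abs_of_pos (a := t) (by linarith)] at ht
          linarith
        · rw [abs_of_neg (a := t) (by linarith)] at ht
          linarith
      have h1 := hz _ this
      simp only [powConv] at h1
      rw [ContinuousLinearMap.mul_apply', h1, mul_zero]
    · simp [powKernel_of_nonpos (not_lt.1 h0)]

/-- The kernel of order one is the indicator of a half-line, so this is the fundamental theorem of
calculus. -/
theorem powConv_one_deriv (he : e = 1 ∨ e = -1) {f : ℝ → ℝ} (hf : ContDiff ℝ ∞ f)
    (hc : HasCompactSupport f) : powConv e 1 (deriv f) = fun x => e * f x := by
  have hd : Continuous (deriv f) := hf.continuous_deriv (by simp)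
  have hdi : Integrable (deriv f) := hd.integrable_of_hasCompactSupport hc.deriv
  have hderiv : ∀ y, HasDerivAt f (deriv f y) y := fun y =>
    (hf.differentiable (by simp) y).hasDerivAt
  ext x
  rw [powConv, convolution_eq_swap]
  simp only [ContinuousLinearMap.mul_apply']
  rcases he with rfl | rfl
  · have e1 : ∫ t, powKernel 1 1 (x - t) * deriv f t = ∫ t in Iio x, deriv f t := by
      rw [← integral_indicator measurableSet_Iio]
      congr with t
      simp [powKernel, indicator_apply]
    rw [e1, ← integral_Iic_eq_integral_Iio,
      integral_Iic_of_hasDerivAt_of_tendsto' (fun y _ => hderiv y) hdi.integrableOn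
      (hc.is_zero_at_infty.mono_left atBot_le_cocompact)]
    simp
  · have e1 : ∫ t, powKernel (-1) 1 (x - t) * deriv f t = ∫ t in Ioi x, deriv f t := by
      rw [← integral_indicator measurableSet_Ioi]
      congr with t
      simp [powKernel, indicator_apply]
    rw [e1, integral_Ioi_of_hasDerivAt_of_tendsto' (fun y _ => hderiv y) hdi.integrableOn
      (hc.is_zero_at_infty.mono_left atTop_le_cocompact)]
    simp

end PowKernel

/-! ### Riemann-Liouville derivatives of test functions -/

section RiemannLiouville

/-- The sign of a direction: `1` for left and `-1` for right. -/
def Side.sign : Side → ℝ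
  | .left => 1
  | .right => -1

theorem Side.sign_eq (s : Side) : s.sign = 1 ∨ s.sign = -1 := by
  cases s
  · exact Or.inl rfl
  · exact Or.inr rfl

theorem Side.sign_opp (s : Side) : s.opp.sign = -s.sign := by
  cases s <;> simp [Side.sign, Side.opp]

theorem fracIntegral_eq (s : Side) (σ : ℝ) (f : ℝ → ℝ) :
    fracIntegral s σ f = fun x => (Real.Gamma σ)⁻¹ * powConv s.sign σ f x := by
  ext x
  rw [powConv, convolution_eq_swap]
  cases s
  · simp only [fracIntegral, Side.sign, ContinuousLinearMap.mul_apply']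
    rw [← integral_indicator measurableSet_Iio]
    congr 2 with t
    simp [powKernel, indicator_apply]
  · simp only [fracIntegral, Side.sign, ContinuousLinearMap.mul_apply']
    rw [← integral_indicator measurableSet_Ioi]
    congr 2 with t
    simp [powKernel, indicator_apply]

theorem IsTestFunction.deriv {Ω : Opens ℝ} {φ : ℝ → ℝ} (hφ : IsTestFunction Ω φ) :
    IsTestFunction Ω (deriv φ) :=
  ⟨hφ.smooth.iterate_deriv 1, hφ.compact.deriv,
    (closure_minimal (support_deriv_subset) isClosed_closure).trans hφ.support⟩

theorem IsTestFunction.iteratedDeriv {Ω : Opens ℝ} {φ : ℝ → ℝ} (hφ : IsTestFunction Ω φ) (k : ℕ) :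
    IsTestFunction Ω (iteratedDeriv k φ) := by
  induction k with
  | zero => simpa using hφ
  | succ k ih => rw [iteratedDeriv_succ]; exact ih.deriv

/-- The order of the fractional integral in the Riemann-Liouville derivative of order `α`. -/
def coOrder (α : ℝ) : ℝ := (⌊α⌋₊ + 1 : ℕ) - α

theorem coOrder_pos (α : ℝ) : 0 < coOrder α := by
  have := Nat.lt_floor_add_one α
  unfold coOrder
  push_cast
  linarith

theorem coOrder_le_one {α : ℝ} (hα : 0 < α) : coOrder α ≤ 1 := by
  have := Nat.floor_le hα.le
  unfold coOrder
  push_cast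
  linarith

theorem coOrder_add (α : ℝ) : coOrder α + α = (⌊α⌋₊ + 1 : ℕ) := by
  simp [coOrder]

/-- All derivatives commute with the convolution and land on φ; `s.sign` absorbs the minus sign of
the right derivative. -/
theorem rlDeriv_eq {Ω : Opens ℝ} {φ : ℝ → ℝ} (hφ : IsTestFunction Ω φ) (s : Side) (α : ℝ) :
    rlDeriv s α φ = fun x => s.sign * (Real.Gamma (coOrder α))⁻¹ *
      powConv s.sign (coOrder α) (iteratedDeriv (⌊α⌋₊ + 1) φ) x := by
  have h : iteratedDeriv (⌊α⌋₊ + 1) (fracIntegral s ((⌊α⌋₊ + 1 : ℕ) - α) φ) =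
      fun x => (Real.Gamma (coOrder α))⁻¹ *
        powConv s.sign (coOrder α) (iteratedDeriv (⌊α⌋₊ + 1) φ) x := by
    rw [fracIntegral_eq, ← iteratedDeriv_powConv s.sign_eq (coOrder_pos α) hφ.smooth hφ.compact]
    ext x
    exact iteratedDeriv_const_mul_field _ _
  ext x
  cases s
  · change iteratedDeriv (⌊α⌋₊ + 1) (fracIntegral .left ((⌊α⌋₊ + 1 : ℕ) - α) φ) x = _
    rw [h]
    simp [Side.sign]
  · change -iteratedDeriv (⌊α⌋₊ + 1) (fracIntegral .right ((⌊α⌋₊ + 1 : ℕ) - α) φ) x = _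
    rw [h]
    simp [Side.sign]

theorem memAllLp_conv {k f : ℝ → ℝ} (hk : Integrable k) (hf : Continuous f)
    (hc : HasCompactSupport f) : MemAllLp (fun x => ∫ t, k t * f (x - t)) volume := by
  have h1 : Integrable (fun x => ∫ t, k t * f (x - t)) :=
    hk.integrable_convolution (ContinuousLinearMap.mul ℝ ℝ)
      (hf.integrable_of_hasCompactSupport hc)
  obtain ⟨C, hC⟩ := hc.exists_bound_of_continuous hf
  refine .of_integrable_of_bound h1 (C := ∫ t, ‖k t‖ * C) fun x => ?_
  refine norm_integral_le_of_norm_le (hk.norm.mul_const C) (Eventually.of_forall fun t => ?_)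
  rw [norm_mul]
  exact mul_le_mul_of_nonneg_left (hC _) (norm_nonneg _)

theorem MemAllLp.add {μ : Measure ℝ} {f g : ℝ → ℝ} (hf : MemAllLp f μ) (hg : MemAllLp g μ) :
    MemAllLp (fun x => f x + g x) μ := fun q hq => (hf q hq).add (hg q hq)

theorem MemAllLp.const_mul {μ : Measure ℝ} {f : ℝ → ℝ} (hf : MemAllLp f μ) (c : ℝ) :
    MemAllLp (fun x => c * f x) μ := fun q hq => (hf q hq).const_mul c

theorem MemAllLp.comp_measurePreserving {f T : ℝ → ℝ} (hf : MemAllLp f volume)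
    (hT : MeasurePreserving T volume volume) : MemAllLp (fun x => f (T x)) volume :=
  fun q hq => (hf q hq).comp_measurePreserving hT

/-- The kernel t^(σ-1) is not integrable at infinity. Splitting at t = 1 and integrating the tail by
parts replaces it there by t^(σ-2), which is, at the price of a boundary term. -/
theorem powConv_deriv_eq {σ : ℝ} (h0 : 0 < σ) (h1 : σ ≤ 1) {ψ : ℝ → ℝ} (hψ : ContDiff ℝ ∞ ψ)
    (hc : HasCompactSupport ψ) : ∃ k₁ k₂ : ℝ → ℝ, Integrable k₁ ∧ Integrable k₂ ∧
      ∀ x, powConv 1 σ (deriv ψ) x =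
        (∫ t, k₁ t * deriv ψ (x - t)) + ψ (x - 1) + ∫ t, k₂ t * ψ (x - t) := by
  have hd : Continuous (deriv ψ) := hψ.continuous_deriv (by simp)
  have hK1 : Integrable ((Ioc (0 : ℝ) 1).indicator (powKernel 1 σ)) := by
    rw [integrable_indicator_iff measurableSet_Ioc]
    exact ((locallyIntegrable_powKernel (Or.inl rfl) h0).integrableOn_isCompact
      isCompact_Icc).mono_set Ioc_subset_Icc_self
  have hK2 : IntegrableOn (fun t : ℝ => (σ - 1) * t ^ (σ - 2)) (Ioi 1) := by
    -- For σ = 1 the factor σ - 1 kills the tail kernel, although t^(-1) is not integrable.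
    rcases h1.eq_or_lt with rfl | h1
    · simp
    · exact (integrableOn_Ioi_rpow_of_lt (by linarith) one_pos).const_mul _
  refine ⟨(Ioc (0 : ℝ) 1).indicator (powKernel 1 σ),
    (Ioi (1 : ℝ)).indicator fun t => (σ - 1) * t ^ (σ - 2), hK1,
    (integrable_indicator_iff measurableSet_Ioi).2 hK2, fun x => ?_⟩
  have hint : Integrable fun t => powKernel 1 σ t * deriv ψ (x - t) :=
    convolutionExists_powKernel (Or.inl rfl) h0 hd hc.deriv x
  have hcx : HasCompactSupport fun t => ψ (x - t) := hc.comp_homeomorph (Homeomorph.subLeft x)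
  obtain ⟨C, hC⟩ := hc.exists_bound_of_continuous hψ.continuous
  have e1 : powConv 1 σ (deriv ψ) x =
      (∫ t, (Ioc (0 : ℝ) 1).indicator (powKernel 1 σ) t * deriv ψ (x - t)) +
        ∫ t in Ioi 1, t ^ (σ - 1) * deriv ψ (x - t) := by
    have a1 : powConv 1 σ (deriv ψ) x = ∫ t in Ioi 0, powKernel 1 σ t * deriv ψ (x - t) := by
      rw [powConv_apply, setIntegral_eq_integral_of_forall_compl_eq_zero]
      intro t ht
      rw [powKernel_of_nonpos (by simpa using ht), zero_mul]
    rw [a1, ← Ioc_union_Ioi_eq_Ioi (zero_le_one' ℝ), setIntegral_union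
      (Ioc_disjoint_Ioi le_rfl) measurableSet_Ioi hint.integrableOn hint.integrableOn]
    congr 1
    · rw [← integral_indicator measurableSet_Ioc]
      congr with t
      by_cases ht : t ∈ Ioc (0 : ℝ) 1 <;> simp [ht]
    · refine setIntegral_congr_fun measurableSet_Ioi fun t ht => ?_
      have ht' : 0 < 1 * t := by linarith [mem_Ioi.1 ht]
      rw [powKernel_of_pos ht', one_mul]
  have hint1 : IntegrableOn (fun t => t ^ (σ - 1) * deriv ψ (x - t)) (Ioi 1) := by
    refine (hint.integrableOn (s := Ioi 1)).congr_fun (fun t ht => ?_) measurableSet_Ioi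
    have ht' : 0 < 1 * t := by linarith [mem_Ioi.1 ht]
    beta_reduce
    rw [powKernel_of_pos ht', one_mul]
  have hint2 : IntegrableOn (fun t => (σ - 1) * t ^ (σ - 2) * ψ (x - t)) (Ioi 1) := by
    refine Integrable.mul_bdd (c := C) hK2 ?_ ?_
    · exact (hψ.continuous.comp (by fun_prop : Continuous fun t => x - t)).aestronglyMeasurable
    · exact Eventually.of_forall fun t => hC _
  have hF : ∀ t ∈ Ici (1 : ℝ), HasDerivAt (fun t => t ^ (σ - 1) * ψ (x - t))
      ((σ - 1) * t ^ (σ - 2) * ψ (x - t) - t ^ (σ - 1) * deriv ψ (x - t)) t := by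
    intro t ht
    have ht0 : t ≠ 0 := by linarith [mem_Ici.1 ht]
    have d1 := Real.hasDerivAt_rpow_const (x := t) (p := σ - 1) (Or.inl ht0)
    have d2 : HasDerivAt (fun t => ψ (x - t)) (-deriv ψ (x - t)) t := by
      simpa [Function.comp_def] using
        (hψ.differentiable (by simp) (x - t)).hasDerivAt.comp t ((hasDerivAt_id t).const_sub x)
    convert! d1.mul d2 using 1
    rw [show σ - 1 - 1 = σ - 2 by ring]
    ring
  have hlim : Tendsto (fun t => t ^ (σ - 1) * ψ (x - t)) atTop (𝓝 0) :=
    (hcx.mul_left (f := fun t => t ^ (σ - 1))).is_zero_at_infty.mono_left atTop_le_cocompact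
  -- The boundary value at t = 1 produces ψ (x - 1); there is none at infinity, by compact support.
  have hI := integral_Ioi_of_hasDerivAt_of_tendsto' hF (hint2.sub hint1) hlim
  rw [integral_sub hint2 hint1] at hI
  simp only [Real.one_rpow, one_mul, zero_sub] at hI
  rw [e1, add_assoc]
  congr 1
  have e2 : ∫ t, (Ioi (1 : ℝ)).indicator (fun t => (σ - 1) * t ^ (σ - 2)) t * ψ (x - t) =
      ∫ t in Ioi 1, (σ - 1) * t ^ (σ - 2) * ψ (x - t) := by
    rw [← integral_indicator measurableSet_Ioi]
    congr with t
    by_cases ht : t ∈ Ioi (1 : ℝ)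
    · rw [indicator_of_mem ht, indicator_of_mem ht]
    · rw [indicator_of_notMem ht, indicator_of_notMem ht, zero_mul]
  rw [e2]
  linarith

theorem powConv_neg_apply (e β : ℝ) (f : ℝ → ℝ) (x : ℝ) :
    powConv (-e) β f x = powConv e β (fun y => f (-y)) (-x) := by
  rw [powConv_apply, powConv_apply, ← integral_neg_eq_self]
  congr with t
  rw [powKernel_neg, neg_neg]
  congr 2
  ring

theorem memAllLp_powConv_deriv {e σ : ℝ} (he : e = 1 ∨ e = -1) (h0 : 0 < σ) (h1 : σ ≤ 1)
    {ψ : ℝ → ℝ} (hψ : ContDiff ℝ ∞ ψ) (hc : HasCompactSupport ψ) :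
    MemAllLp (powConv e σ (deriv ψ)) volume := by
  have key : ∀ ψ : ℝ → ℝ, ContDiff ℝ ∞ ψ → HasCompactSupport ψ →
      MemAllLp (powConv 1 σ (deriv ψ)) volume := by
    intro ψ hψ hc
    obtain ⟨k₁, k₂, hk₁, hk₂, h⟩ := powConv_deriv_eq h0 h1 hψ hc
    rw [funext h]
    exact ((memAllLp_conv hk₁ (hψ.continuous_deriv (by simp)) hc.deriv).add
      ((MemAllLp.of_hasCompactSupport hψ.continuous hc).comp_measurePreserving
        (measurePreserving_sub_right volume 1))).add (memAllLp_conv hk₂ hψ.continuous hc)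
  rcases he with rfl | rfl
  · exact key ψ hψ hc
  · have e1 : powConv (-1) σ (deriv ψ) =
        fun x => (-1) * powConv 1 σ (deriv fun y => ψ (-y)) (-x) := by
      ext x
      rw [powConv_neg_apply]
      have : deriv (fun y => ψ (-y)) = fun y => (-1) * deriv ψ (-y) := by
        ext y
        rw [deriv_comp_neg]
        ring
      rw [this, powConv_const_mul]
      ring
    rw [e1]
    exact ((key _ (hψ.comp contDiff_neg) (hc.comp_homeomorph (Homeomorph.neg ℝ))
      ).comp_measurePreserving (Measure.measurePreserving_neg volume)).const_mul _

/-- Makes the pairing with any u in `L^p` absolutely convergent. One of the m + 1 derivatives on φ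
is spent on decay at infinity. -/
theorem memAllLp_rlDeriv {Ω : Opens ℝ} {φ : ℝ → ℝ} (hφ : IsTestFunction Ω φ) (s : Side) {α : ℝ}
    (hα : 0 < α) : MemAllLp (rlDeriv s α φ) volume := by
  rw [rlDeriv_eq hφ, iteratedDeriv_succ]
  exact (memAllLp_powConv_deriv s.sign_eq (coOrder_pos α) (coOrder_le_one hα)
    (hφ.iteratedDeriv _).smooth (hφ.iteratedDeriv _).compact).const_mul _

theorem powConv_comp_add (e β : ℝ) (f : ℝ → ℝ) (y : ℝ) :
    powConv e β (fun x => f (x + y)) = fun x => powConv e β f (x + y) := by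
  ext x
  simp_rw [powConv_apply]
  congr with t
  rw [sub_add_eq_add_sub]

theorem IsTestFunction.comp_add {φ : ℝ → ℝ} (hφ : IsTestFunction ⊤ φ) (y : ℝ) :
    IsTestFunction ⊤ fun x => φ (x + y) :=
  ⟨hφ.smooth.comp (by fun_prop), hφ.compact.comp_homeomorph (Homeomorph.addRight y),
    subset_univ _⟩

theorem rlDeriv_comp_add {φ : ℝ → ℝ} (hφ : IsTestFunction ⊤ φ) (s : Side) (α y : ℝ) :
    rlDeriv s α (fun x => φ (x + y)) = fun x => rlDeriv s α φ (x + y) := by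
  rw [rlDeriv_eq hφ, rlDeriv_eq (hφ.comp_add y), iteratedDeriv_comp_add_const, powConv_comp_add]

end RiemannLiouville

/-! ### Closedness of weak derivatives and completeness -/

section Closedness

variable {Ω : Opens ℝ} {c : ℝ} {T : (ℝ → ℝ) → ℝ → ℝ} {p : ℝ≥0∞} [Fact (1 ≤ p)]

theorem IsTestFunction.memAllLp {φ : ℝ → ℝ} (hφ : IsTestFunction Ω φ) :
    MemAllLp φ (volume.restrict (Ω : Set ℝ)) :=
  (MemAllLp.of_hasCompactSupport (μ := volume) hφ.smooth.continuous hφ.compact).restrict _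

theorem IsTestFunction.memAllLp_rlDeriv {φ : ℝ → ℝ} (hφ : IsTestFunction Ω φ) (s : Side) {α : ℝ}
    (hα : 0 < α) : MemAllLp (rlDeriv s α φ) (volume.restrict (Ω : Set ℝ)) :=
  (_root_.memAllLp_rlDeriv hφ s hα).restrict _

/-- For each φ both sides of the defining identity are continuous functionals on `L^p`. -/
theorem HasDualDeriv.of_tendsto
    (hT : ∀ φ, IsTestFunction Ω φ → MemAllLp (T φ) (volume.restrict (Ω : Set ℝ)))
    {ι : Type*} {l : Filter ι} [l.NeBot] {u v : ι → LpOn p Ω} {u₀ v₀ : LpOn p Ω}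
    (hu : Tendsto u l (𝓝 u₀)) (hv : Tendsto v l (𝓝 v₀))
    (h : ∀ i, HasDualDeriv Ω c T (u i) (v i)) : HasDualDeriv Ω c T u₀ v₀ := by
  refine ⟨LpOn.locallyIntegrableOn Fact.out _, fun φ hφ =>
    ⟨(hT φ hφ).integrable_mul (Lp.memLp u₀), ?_⟩⟩
  obtain ⟨L, hL⟩ := hφ.memAllLp.exists_pairing (p := p)
  obtain ⟨M, hM⟩ := (hT φ hφ).exists_pairing (p := p)
  rw [← hL, ← hM]
  refine tendsto_nhds_unique ((L.continuous.tendsto _).comp hv) ?_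
  refine (((M.continuous.tendsto _).comp hu).const_mul c).congr fun i => ?_
  simp only [Function.comp_apply]
  rw [hL, hM, ((h i).2 φ hφ).2]

end Closedness

namespace FracSobolev

variable {s : Side} {α : ℝ} {p : ℝ≥0∞} [Fact (1 ≤ p)] {Ω : Opens ℝ}

theorem exists_of_hasWeakDeriv {f : LpOn p Ω} {w : Fin (⌊α⌋₊ + 1) → LpOn p Ω} {v : LpOn p Ω}
    (hw : ∀ k : Fin (⌊α⌋₊ + 1), HasWeakDeriv Ω k f (w k)) (hv : HasWeakFracDeriv s α Ω f v) :
    ∃ u : FracSobolev s α p Ω, toLp u = f ∧ (∀ k, weakDeriv k u = w k) ∧ weakFracDeriv u = v := by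
  let u : FracSobolev s α p Ω :=
    ⟨f, mem_fracSobolevSubmodule.2 ⟨fun k => ⟨w k, hw k⟩, ⟨v, hv⟩⟩⟩
  have hu : toLp u = f := rfl
  refine ⟨u, hu, fun k => Lp.ext ((hasWeakDeriv k u).unique (hw k)),
    Lp.ext ((hasWeakFracDeriv u).unique hv)⟩

theorem isometry_jet : Isometry (jet (s := s) (α := α) (p := p) (Ω := Ω)) :=
  AddMonoidHomClass.isometry_of_norm _ fun _ => rfl

theorem tendsto_jet_target_iff {ι : Type*} {l : Filter ι}
    {x : ι → WithLp p (PiLp p (fun _ : Fin (⌊α⌋₊ + 1) => LpOn p Ω) × LpOn p Ω)}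
    {y : WithLp p (PiLp p (fun _ : Fin (⌊α⌋₊ + 1) => LpOn p Ω) × LpOn p Ω)} :
    Tendsto x l (𝓝 y) ↔
      (∀ k, Tendsto (fun i => (x i).fst k) l (𝓝 (y.fst k))) ∧
        Tendsto (fun i => (x i).snd) l (𝓝 y.snd) := by
  rw [(WithLp.prodContinuousLinearEquiv p ℝ _ _).toHomeomorph.isInducing.tendsto_nhds_iff,
    nhds_prod_eq, tendsto_prod_iff']
  refine and_congr ?_ Iff.rfl
  rw [(PiLp.continuousLinearEquiv p ℝ _).toHomeomorph.isInducing.tendsto_nhds_iff, tendsto_pi_nhds]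
  rfl

theorem tendsto_iff {ι : Type*} {l : Filter ι} {u : ι → FracSobolev s α p Ω}
    {u₀ : FracSobolev s α p Ω} :
    Tendsto u l (𝓝 u₀) ↔ (∀ k, Tendsto (fun i => weakDeriv k (u i)) l (𝓝 (weakDeriv k u₀))) ∧
      Tendsto (fun i => weakFracDeriv (u i)) l (𝓝 (weakFracDeriv u₀)) := by
  rw [isometry_jet.isEmbedding.isInducing.tendsto_nhds_iff, tendsto_jet_target_iff]
  rfl

theorem exists_of_tendsto (hα : 0 < α) {ι : Type*} {l : Filter ι} [l.NeBot]
    {u : ι → FracSobolev s α p Ω} {w : Fin (⌊α⌋₊ + 1) → LpOn p Ω} {v : LpOn p Ω}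
    (hw : ∀ k, Tendsto (fun i => weakDeriv k (u i)) l (𝓝 (w k)))
    (hv : Tendsto (fun i => weakFracDeriv (u i)) l (𝓝 v)) :
    ∃ u₀ : FracSobolev s α p Ω, Tendsto u l (𝓝 u₀) ∧ (∀ k, weakDeriv k u₀ = w k) ∧
      weakFracDeriv u₀ = v := by
  have h0 : Tendsto (fun i => toLp (u i)) l (𝓝 (w 0)) := by
    simpa only [weakDeriv_zero_order] using hw 0
  obtain ⟨u₀, -, h1, h2⟩ := exists_of_hasWeakDeriv (s := s) (α := α)
    (fun k => HasDualDeriv.of_tendsto (fun φ hφ => (hφ.iteratedDeriv k).memAllLp) h0 (hw k)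
      fun i => hasWeakDeriv k (u i))
    (HasDualDeriv.of_tendsto (fun φ hφ => hφ.memAllLp_rlDeriv s.opp hα) h0 hv
      fun i => hasWeakFracDeriv (u i))
  refine ⟨u₀, tendsto_iff.2 ⟨fun k => ?_, ?_⟩, h1, h2⟩
  · rw [h1]; exact hw k
  · rw [h2]; exact hv

/-- The isometry `jet` embeds the space in a product of `L^p` spaces; closedness of the weak
derivatives makes its range closed. -/
theorem completeSpace (hα : 0 < α) : CompleteSpace (FracSobolev s α p Ω) := by
  rw [completeSpace_iff_isComplete_range isometry_jet.isUniformInducing]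
  refine IsClosed.isComplete (IsSeqClosed.isClosed fun x y hx hy => ?_)
  choose u hu using hx
  obtain ⟨h1, h2⟩ := tendsto_jet_target_iff.1 hy
  obtain ⟨u₀, hu₀, -⟩ := exists_of_tendsto (u := u) hα
    (fun k => (h1 k).congr fun i => by rw [← hu]; rfl) (h2.congr fun i => by rw [← hu]; rfl)
  refine ⟨u₀, tendsto_nhds_unique ?_ hy⟩
  exact ((isometry_jet.continuous.tendsto u₀).comp hu₀).congr hu

end FracSobolev

/-- The completion of a dense subspace of a Banach space is the space. -/
theorem exists_completion_linearIsometryEquiv {E : Type*} [NormedAddCommGroup E] [NormedSpace ℝ E]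
    [CompleteSpace E] (S : Submodule ℝ E) (hS : Dense (S : Set E)) :
    ∃ Φ : UniformSpace.Completion S ≃ₗᵢ[ℝ] E,
      ∀ f : S, Φ (f : UniformSpace.Completion S) = (f : E) := by
  let g : UniformSpace.Completion S →L[ℝ] E := S.subtypeL.extend
    (UniformSpace.Completion.toComplL (𝕜 := ℝ) (E := S))
  have hg : ∀ f : S, g (f : UniformSpace.Completion S) = (f : E) := fun f =>
    ContinuousLinearMap.extend_eq _ (UniformSpace.Completion.denseRange_coe)
      (UniformSpace.Completion.isUniformInducing_coe S) f
  have hn : ∀ x, ‖g x‖ = ‖x‖ := by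
    intro x
    induction x using UniformSpace.Completion.induction_on with
    | hp => exact isClosed_eq (by fun_prop) (by fun_prop)
    | ih f => rw [hg, UniformSpace.Completion.norm_coe]; rfl
  let G : UniformSpace.Completion S →ₗᵢ[ℝ] E := ⟨g.toLinearMap, hn⟩
  have hsurj : Function.Surjective G := by
    -- An isometric image of a complete space is closed, and this one contains the dense set S.
    rw [← range_eq_univ, ← G.isometry.isClosedEmbedding.isClosed_range.closure_eq]
    refine (hS.mono ?_).closure_eq
    intro f hf
    exact ⟨((⟨f, hf⟩ : S) : UniformSpace.Completion S), hg ⟨f, hf⟩⟩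
  exact ⟨LinearIsometryEquiv.ofSurjective G hsurj, hg⟩

/-! ### Restriction to Ω and extension by zero -/

section Restriction

variable {Ω : Opens ℝ} {p : ℝ≥0∞} [Fact (1 ≤ p)]

/-- Restriction of functions in `L^p(ℝ)` to `Ω`. -/
def restrictLp (p : ℝ≥0∞) [Fact (1 ≤ p)] (Ω : Opens ℝ) :
    Lp ℝ p (volume : Measure ℝ) →L[ℝ] LpOn p Ω :=
  LpToLpRestrictCLM ℝ ℝ ℝ volume p Ω

theorem coeFn_restrictLp (f : Lp ℝ p (volume : Measure ℝ)) :
    restrictLp p Ω f =ᵐ[volume.restrict (Ω : Set ℝ)] f :=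
  LpToLpRestrictCLM_coeFn ℝ _ f

theorem norm_restrictLp_le (f : Lp ℝ p (volume : Measure ℝ)) : ‖restrictLp p Ω f‖ ≤ ‖f‖ :=
  norm_Lp_toLp_restrict_le _ f

/-- Extension by zero. -/
def extendLp (f : LpOn p Ω) : Lp ℝ p (volume : Measure ℝ) :=
  ((memLp_indicator_iff_restrict Ω.isOpen.measurableSet).2 (Lp.memLp f)).toLp
    ((Ω : Set ℝ).indicator f)

theorem coeFn_extendLp (f : LpOn p Ω) : extendLp f =ᵐ[volume] (Ω : Set ℝ).indicator f :=
  MemLp.coeFn_toLp _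

theorem restrictLp_extendLp (f : LpOn p Ω) : restrictLp p Ω (extendLp f) = f := by
  have h : extendLp f =ᵐ[volume.restrict (Ω : Set ℝ)] (Ω : Set ℝ).indicator f :=
    ae_restrict_of_ae (coeFn_extendLp f)
  exact Lp.ext ((coeFn_restrictLp _).trans (h.trans
    (indicator_ae_eq_restrict Ω.isOpen.measurableSet)))

theorem integral_extendLp_mul (f : LpOn p Ω) (g : ℝ → ℝ) :
    ∫ x, extendLp f x * g x = ∫ x in (Ω : Set ℝ), f x * g x := by
  rw [← integral_indicator Ω.isOpen.measurableSet]
  refine integral_congr_ae ?_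
  filter_upwards [coeFn_extendLp f] with x hx
  rw [hx]
  by_cases h : x ∈ (Ω : Set ℝ) <;> simp [h]

theorem integral_lpShift_mul (f : Lp ℝ p (volume : Measure ℝ)) (g : ℝ → ℝ) (y : ℝ) :
    ∫ x, lpShift p y f x * g x = ∫ x, f x * g (x + y) := by
  rw [← integral_sub_right_eq_self (fun x => f x * g (x + y)) y]
  refine integral_congr_ae ?_
  filter_upwards [coeFn_lpShift y f] with x hx
  rw [hx, sub_add_cancel]

theorem contDiff_conv_lp {k : ℝ → ℝ} (hk : ContDiff ℝ ∞ k) (hc : HasCompactSupport k)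
    (f : Lp ℝ p (volume : Measure ℝ)) : ContDiff ℝ ∞ fun x => ∫ y, k y * f (x - y) :=
  hc.contDiff_convolution_left (ContinuousLinearMap.mul ℝ ℝ) hk
    ((Lp.memLp f).locallyIntegrable Fact.out)

end Restriction

/-! ### Density on the whole line by mollification -/

section WholeLine

variable {p : ℝ≥0∞} [Fact (1 ≤ p)] {c : ℝ} {T : (ℝ → ℝ) → ℝ → ℝ} {k : ℝ → ℝ}

/-- Convolution commutes with translation invariant weak derivatives on the line. -/
theorem HasDualDeriv.lpConv (hp : p ≠ ⊤) (hk : Integrable k)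
    (hT : ∀ φ, IsTestFunction ⊤ φ → MemAllLp (T φ) volume)
    (hTs : ∀ φ, IsTestFunction ⊤ φ → ∀ y, T (fun x => φ (x + y)) = fun x => T φ (x + y))
    {u v : LpOn p ⊤} (h : HasDualDeriv ⊤ c T u v) :
    HasDualDeriv ⊤ c T (restrictLp p ⊤ (lpConv k (extendLp u)))
      (restrictLp p ⊤ (lpConv k (extendLp v))) := by
  refine ⟨LpOn.locallyIntegrableOn Fact.out _, fun φ hφ =>
    ⟨((hT φ hφ).restrict _).integrable_mul (Lp.memLp _), ?_⟩⟩
  have hφa : MemAllLp φ volume := .of_hasCompactSupport hφ.smooth.continuous hφ.compact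
  obtain ⟨L, hL⟩ := hφa.exists_pairing (p := p)
  obtain ⟨M, hM⟩ := (hT φ hφ).exists_pairing (p := p)
  have e : ∀ (F : Lp ℝ p (volume : Measure ℝ)) (g : ℝ → ℝ),
      ∫ x in ((⊤ : Opens ℝ) : Set ℝ), restrictLp p ⊤ F x * g x = ∫ x, F x * g x := by
    intro F g
    rw [← setIntegral_univ (f := fun x => F x * g x)]
    refine integral_congr_ae ?_
    filter_upwards [coeFn_restrictLp F] with x hx
    rw [hx]
  -- The functionals move under the `L^p`-valued integral, and each shift is transferred to the test
  -- function, where T commutes with it.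
  rw [e, e, ← hL, ← hM, map_lpConv hp hk, map_lpConv hp hk, ← integral_const_mul]
  congr with y
  rw [hL, hM, integral_lpShift_mul, integral_lpShift_mul,
    integral_extendLp_mul v fun x => φ (x + y), integral_extendLp_mul u fun x => T φ (x + y),
    (h.2 _ (hφ.comp_add y)).2, hTs φ hφ y]
  ring

theorem FracSobolev.dense_smoothPart_top (hp : p ≠ ⊤) (s : Side) {α : ℝ} (hα : 0 < α) :
    Dense (FracSobolev.smoothPart s α p ⊤ : Set (FracSobolev s α p ⊤)) := by
  intro u
  let k : ℕ → ContDiffBump (0 : ℝ) := fun n =>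
    ⟨1 / ((n : ℝ) + 1) / 2, 1 / ((n : ℝ) + 1), by positivity, half_lt_self (by positivity)⟩
  have hk : Tendsto (fun n => (k n).rOut) atTop (𝓝 0) := tendsto_one_div_add_atTop_nhds_zero_nat
  have hki : ∀ n, Integrable ((k n).normed volume) := fun n => (k n).integrable_normed
  let F : ℕ → LpOn p ⊤ → LpOn p ⊤ := fun n f =>
    restrictLp p ⊤ (_root_.lpConv ((k n).normed volume) (extendLp f))
  have hF : ∀ f, Tendsto (fun n => F n f) atTop (𝓝 f) := fun f => by
    have := ((restrictLp p ⊤).continuous.tendsto _).comp (tendsto_lpConv hp hk (extendLp f))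
    rwa [restrictLp_extendLp] at this
  have hex : ∀ n, ∃ U : FracSobolev s α p ⊤, toLp U = F n (toLp u) ∧
      (∀ j, weakDeriv j U = F n (weakDeriv j u)) ∧ weakFracDeriv U = F n (weakFracDeriv u) := by
    intro n
    refine exists_of_hasWeakDeriv (fun j => ?_) ?_
    · refine HasDualDeriv.lpConv hp (hki n) (fun φ hφ => ?_) (fun φ hφ y => ?_) (hasWeakDeriv j u)
      · exact .of_hasCompactSupport (hφ.iteratedDeriv j).smooth.continuous
          (hφ.iteratedDeriv j).compact
      · exact iteratedDeriv_comp_add_const _ _ _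
    · exact HasDualDeriv.lpConv hp (hki n) (fun φ hφ => memAllLp_rlDeriv hφ _ hα)
        (fun φ hφ y => rlDeriv_comp_add hφ _ _ _) (hasWeakFracDeriv u)
  choose U hU0 hUk hUf using hex
  refine mem_closure_of_tendsto (b := atTop) (f := U) (tendsto_iff.2 ⟨fun j => ?_, ?_⟩)
    (Eventually.of_forall fun n => ?_)
  · simp_rw [hUk]; exact hF _
  · simp_rw [hUf]; exact hF _
  · refine ⟨fun x => ∫ y, (k n).normed volume y * extendLp (toLp u) (x - y),
      (contDiff_conv_lp (k n).contDiff_normed (k n).hasCompactSupport_normed _).contDiffOn, ?_⟩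
    rw [hU0]
    exact (coeFn_restrictLp _).trans (ae_restrict_of_ae (coeFn_lpConv hp (hki n) _))

end WholeLine

/-! ### Classical derivatives as weak derivatives -/

section ClassicalDerivatives

variable {Ω : Opens ℝ}

theorem IsTestFunction.setIntegral_mul_eq {φ : ℝ → ℝ} (hφ : IsTestFunction Ω φ) (f : ℝ → ℝ) :
    ∫ x in (Ω : Set ℝ), f x * φ x = ∫ x, f x * φ x := by
  refine setIntegral_eq_integral_of_forall_compl_eq_zero fun x hx => ?_
  rw [image_eq_zero_of_notMem_tsupport fun h => hx (hφ.support h), mul_zero]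

theorem IsTestFunction.eq_zero {φ : ℝ → ℝ} (hφ : IsTestFunction Ω φ) {x : ℝ} (hx : x ∉ Ω) :
    φ x = 0 :=
  image_eq_zero_of_notMem_tsupport fun h => hx (hφ.support h)

theorem contDiffOn_deriv {f : ℝ → ℝ} (hf : ContDiffOn ℝ ∞ f Ω) : ContDiffOn ℝ ∞ (deriv f) Ω :=
  ((contDiffOn_infty_iff_deriv_of_isOpen Ω.isOpen).1 hf).2

theorem ContDiffOn.locallyIntegrableOn_opens {f : ℝ → ℝ} (hf : ContDiffOn ℝ ∞ f Ω) :
    LocallyIntegrableOn f Ω :=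
  hf.continuousOn.locallyIntegrableOn Ω.isOpen.measurableSet

theorem setIntegral_mul_deriv_of_contDiffOn {f φ : ℝ → ℝ} (hf : ContDiffOn ℝ ∞ f Ω)
    (hφ : IsTestFunction Ω φ) :
    ∫ x in (Ω : Set ℝ), f x * deriv φ x = -∫ x in (Ω : Set ℝ), deriv f x * φ x := by
  have hder : ∀ x, HasDerivAt (fun x => f x * φ x) (deriv f x * φ x + f x * deriv φ x) x := by
    intro x
    -- Nothing is known of f off Ω, but the product vanishes near every point there, so it is
    -- differentiable on the whole line and no boundary terms arise.
    by_cases hx : x ∈ Ω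
    · have h1 : DifferentiableAt ℝ f x :=
        (hf.contDiffAt (Ω.isOpen.mem_nhds hx)).differentiableAt (by simp)
      exact h1.hasDerivAt.mul (hφ.smooth.differentiable (by simp) x).hasDerivAt
    · have h1 : x ∉ tsupport φ := fun h => hx (hφ.support h)
      have h2 : (fun x => f x * φ x) =ᶠ[𝓝 x] fun _ => 0 := by
        filter_upwards [notMem_tsupport_iff_eventuallyEq.1 h1] with y hy
        simp [hy]
      rw [hφ.eq_zero hx, hφ.deriv.eq_zero hx]
      simpa using (hasDerivAt_const x (0 : ℝ)).congr_of_eventuallyEq h2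
  have hfull : ∀ {g ψ : ℝ → ℝ}, LocallyIntegrableOn g Ω → IsTestFunction Ω ψ →
      Integrable fun x => g x * ψ x := by
    intro g ψ hg hψ
    refine (integrableOn_iff_integrable_of_support_subset ?_).1 (hψ.integrable_mul hg)
    intro x hx
    by_contra h
    exact hx (by simp [hψ.eq_zero h])
  have i0 := hfull hf.locallyIntegrableOn_opens hφ
  have i1 := hfull (contDiffOn_deriv hf).locallyIntegrableOn_opens hφ
  have i2 := hfull hf.locallyIntegrableOn_opens hφ.deriv
  have h := integral_eq_zero_of_hasDerivAt_of_integrable hder (i1.add i2) i0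
  rw [integral_add i1 i2] at h
  rw [hφ.setIntegral_mul_eq, hφ.deriv.setIntegral_mul_eq]
  linarith

theorem contDiffOn_iteratedDeriv {f : ℝ → ℝ} (hf : ContDiffOn ℝ ∞ f Ω) (k : ℕ) :
    ContDiffOn ℝ ∞ (iteratedDeriv k f) Ω := by
  induction k with
  | zero => simpa using hf
  | succ k ih => rw [iteratedDeriv_succ]; exact contDiffOn_deriv ih

/-- Classical derivatives are weak derivatives. -/
theorem hasWeakDeriv_iteratedDeriv {f : ℝ → ℝ} (hf : ContDiffOn ℝ ∞ f Ω) (k : ℕ) :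
    HasWeakDeriv Ω k f (iteratedDeriv k f) := by
  refine ⟨(contDiffOn_iteratedDeriv hf k).locallyIntegrableOn_opens, fun φ hφ =>
    ⟨(hφ.iteratedDeriv k).integrable_mul hf.locallyIntegrableOn_opens, ?_⟩⟩
  induction k generalizing φ with
  | zero => simp
  | succ k ih =>
    have h := ih _ hφ.deriv
    rw [setIntegral_mul_deriv_of_contDiffOn (contDiffOn_iteratedDeriv hf k) hφ] at h
    beta_reduce at h ⊢
    rw [iteratedDeriv_succ, iteratedDeriv_succ', pow_succ]
    linear_combination -h

end ClassicalDerivatives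

/-! ### The du Bois-Reymond lemma -/

section DuBoisReymond

variable {Ω : Opens ℝ} {a b : ℝ}

/-- On an interval, a test function of mean zero is the derivative of a test function. -/
theorem IsTestFunction.exists_deriv_eq (hΩ : (Ω : Set ℝ) = Ioo a b) {θ : ℝ → ℝ}
    (hθ : IsTestFunction Ω θ) (h0 : ∫ x, θ x = 0) : ∃ φ, IsTestFunction Ω φ ∧ _root_.deriv φ = θ := by
  have hint : Integrable θ := hθ.smooth.continuous.integrable_of_hasCompactSupport hθ.compact
  have hd : ∀ x, HasDerivAt (fun x => ∫ y in a..x, θ y) (θ x) x := fun x =>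
    intervalIntegral.integral_hasDerivAt_right hint.intervalIntegrable
      hθ.smooth.continuous.stronglyMeasurable.stronglyMeasurableAtFilter
      hθ.smooth.continuous.continuousAt
  have hder : _root_.deriv (fun x => ∫ y in a..x, θ y) = θ := funext fun x => (hd x).deriv
  have hK : ∃ c d, tsupport θ ⊆ Icc c d ∧ a < c ∧ d < b := by
    rcases (tsupport θ).eq_empty_or_nonempty with he | hne
    · exact ⟨a + 1, b - 1, by simp [he], by linarith, by linarith⟩
    · obtain ⟨c, hc, hc'⟩ := hθ.compact.isCompact.exists_isLeast hne
      obtain ⟨d, hd, hd'⟩ := hθ.compact.isCompact.exists_isGreatest hne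
      have h1 := hθ.support hc
      have h2 := hθ.support hd
      rw [SetLike.mem_coe, ← SetLike.mem_coe, hΩ] at h1 h2
      exact ⟨c, d, fun x hx => ⟨hc' hx, hd' hx⟩, h1.1, h2.2⟩
  obtain ⟨c, d, hcd, hac, hdb⟩ := hK
  have hz : ∀ x, x ∉ Icc c d → θ x = 0 := fun x hx =>
    image_eq_zero_of_notMem_tsupport fun h => hx (hcd h)
  have hleft : ∀ x, x < c → ∫ y in a..x, θ y = 0 := by
    intro x hx
    refine intervalIntegral.integral_zero_ae (Eventually.of_forall fun y hy => hz y fun h => ?_)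
    have := hy.2
    rcases le_max_iff.1 this with h' | h' <;> linarith [h.1]
  have hright : ∀ x, d < x → ∫ y in a..x, θ y = 0 := by
    intro x hx
    rcases lt_or_ge x c with hxc | hxc
    · exact hleft x hxc
    -- To the right of the support the primitive equals the total integral, which is zero.
    rw [intervalIntegral.integral_of_le (by linarith),
      setIntegral_eq_integral_of_forall_compl_eq_zero, h0]
    intro y hy
    refine hz y fun h => hy ⟨by linarith [h.1], by linarith [h.2]⟩
  have hsupp : tsupport (fun x => ∫ y in a..x, θ y) ⊆ Icc c d := by
    refine closure_minimal (fun x hx => ?_) isClosed_Icc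
    by_contra h
    rcases not_and_or.1 h with h | h
    · exact hx (hleft x (not_le.1 h))
    · exact hx (hright x (not_le.1 h))
  refine ⟨fun x => ∫ y in a..x, θ y, ⟨?_, ?_, ?_⟩, hder⟩
  · rw [contDiff_infty_iff_deriv, hder]
    exact ⟨fun x => (hd x).differentiableAt, hθ.smooth⟩
  · exact isCompact_Icc.of_isClosed_subset (isClosed_tsupport _) hsupp
  · rw [hΩ]
    exact hsupp.trans fun x hx => ⟨by linarith [hx.1], by linarith [hx.2]⟩

theorem exists_isTestFunction_integral_eq_one (hab : a < b) (hΩ : (Ω : Set ℝ) = Ioo a b) :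
    ∃ χ, IsTestFunction Ω χ ∧ ∫ x, χ x = 1 := by
  let B : ContDiffBump ((a + b) / 2) := ⟨(b - a) / 8, (b - a) / 4, by linarith, by linarith⟩
  refine ⟨B.normed volume, ⟨B.contDiff_normed, B.hasCompactSupport_normed, ?_⟩, B.integral_normed⟩
  rw [B.tsupport_normed_eq, hΩ, Real.closedBall_eq_Icc]
  intro x hx
  have h1 := hx.1
  have h2 := hx.2
  simp only [B] at h1 h2
  constructor <;> linarith

/-- The lemma of du Bois-Reymond for derivatives of arbitrary order. -/
theorem exists_polynomial_of_integral_iteratedDeriv_eq_zero (hab : a < b)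
    (hΩ : (Ω : Set ℝ) = Ioo a b) (n : ℕ) {w : ℝ → ℝ} (hw : LocallyIntegrableOn w Ω)
    (h : ∀ φ, IsTestFunction Ω φ → ∫ x in (Ω : Set ℝ), w x * iteratedDeriv n φ x = 0) :
    ∃ P : Polynomial ℝ, w =ᵐ[volume.restrict (Ω : Set ℝ)] fun x => P.eval x := by
  induction n generalizing w with
  | zero =>
    -- For n = 0, w and 0 are both dual derivatives of 0 under the zero operator, so uniqueness
    -- gives w = 0.
    refine ⟨0, HasDualDeriv.unique (c := 1) (T := fun _ => 0) (u := 0)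
      ⟨hw, fun φ hφ => ⟨by simp, by simpa using h φ hφ⟩⟩ ?_⟩
    simp only [Polynomial.eval_zero]
    exact HasDualDeriv.zero
  | succ n ih =>
    obtain ⟨χ, hχ, hχ1⟩ := exists_isTestFunction_integral_eq_one hab hΩ
    set A : ℝ := ∫ x in (Ω : Set ℝ), w x * iteratedDeriv n χ x with hA
    -- Chosen so that (-1)^n times the n-th derivative of q x^n is A.
    let q : ℝ := A * (-1) ^ n / n.factorial
    have hpow : ContDiffOn ℝ ∞ (fun x : ℝ => q * x ^ n) Ω := by fun_prop
    have hw' : LocallyIntegrableOn (fun x => w x - q * x ^ n) Ω :=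
      hw.sub hpow.locallyIntegrableOn_opens
    obtain ⟨P, hP⟩ := ih hw' fun ψ hψ => by
      have hψn := hψ.iteratedDeriv n
      have hχn := hχ.iteratedDeriv n
      set I : ℝ := ∫ x, ψ x with hI
      -- Removing the mean makes ψ - I χ the derivative of a test function φ. Testing with φ gives ∫
      -- w ψ^(n) = A I, exactly what q x^n contributes, so the difference falls under the induction
      -- hypothesis.
      have hθ : IsTestFunction Ω fun x => ψ x - I * χ x := by
        refine ⟨hψ.smooth.sub (contDiff_const.mul hχ.smooth), ?_, ?_⟩
        · exact hψ.compact.sub (hχ.compact.mul_left)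
        · refine (tsupport_sub ψ fun x => I * χ x).trans (union_subset hψ.support ?_)
          exact (tsupport_mul_subset_right (f := fun _ => I)).trans hχ.support
      have hθ0 : ∫ x, ψ x - I * χ x = 0 := by
        rw [integral_sub (hψ.smooth.continuous.integrable_of_hasCompactSupport hψ.compact)
          ((hχ.smooth.continuous.integrable_of_hasCompactSupport hχ.compact).const_mul _),
          integral_const_mul, hχ1, mul_one, sub_self]
      obtain ⟨φ, hφ, hφθ⟩ := hθ.exists_deriv_eq hΩ hθ0
      have h1 := h φ hφ
      have e1 : iteratedDeriv n (fun x => ψ x - I * χ x) =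
          fun x => iteratedDeriv n ψ x - I * iteratedDeriv n χ x := by
        ext x
        rw [iteratedDeriv_fun_sub (hψ.smooth.contDiffAt.of_le (by exact_mod_cast le_top))
          ((contDiff_const.mul hχ.smooth).contDiffAt.of_le (by exact_mod_cast le_top)),
          iteratedDeriv_const_mul_field]
      rw [iteratedDeriv_succ', hφθ, e1] at h1
      have e2 : (fun x => w x * (iteratedDeriv n ψ x - I * iteratedDeriv n χ x)) =
          fun x => w x * iteratedDeriv n ψ x - I * (w x * iteratedDeriv n χ x) := by
        ext x; ring
      rw [e2, integral_sub (hψn.integrable_mul hw) ((hχn.integrable_mul hw).const_mul _),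
        integral_const_mul, ← hA] at h1
      have e3 : (fun x => (w x - q * x ^ n) * iteratedDeriv n ψ x) =
          fun x => w x * iteratedDeriv n ψ x - q * x ^ n * iteratedDeriv n ψ x := by
        ext x; ring
      have h2 := ((hasWeakDeriv_iteratedDeriv hpow n).2 ψ hψ).2
      have e4 : iteratedDeriv n (fun x : ℝ => q * x ^ n) = fun _ => q * n.factorial := by
        ext x
        rw [iteratedDeriv_const_mul_field, iteratedDeriv_pow]
        simp [Nat.descFactorial_self]
      rw [e4, integral_const_mul, show ∫ x in (Ω : Set ℝ), ψ x = I by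
        simpa using hψ.setIntegral_mul_eq fun _ => 1] at h2
      rw [e3, integral_sub (hψn.integrable_mul hw)
        (hψn.integrable_mul hpow.locallyIntegrableOn_opens)]
      have hf : (n.factorial : ℝ) ≠ 0 := by positivity
      have hs : ((-1 : ℝ) ^ n) * (-1) ^ n = 1 := by rw [← mul_pow]; simp
      have h3 : q * n.factorial = A * (-1) ^ n := by simp only [q]; field_simp
      rw [h3] at h2
      have h4 : ∫ x in (Ω : Set ℝ), q * x ^ n * iteratedDeriv n ψ x = A * I := by
        linear_combination (A * I - ∫ x in (Ω : Set ℝ), q * x ^ n * iteratedDeriv n ψ x) * hs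
          - (-1 : ℝ) ^ n * h2
      rw [h4]
      linarith
    refine ⟨P + Polynomial.C q * Polynomial.X ^ n, ?_⟩
    filter_upwards [hP] with x hx
    simp only [Polynomial.eval_add, Polynomial.eval_mul, Polynomial.eval_C, Polynomial.eval_pow,
      Polynomial.eval_X, ← hx]
    ring

end DuBoisReymond

/-! ### The adjoint of a convolution -/

section Duality

theorem integral_conv_mul {p : ℝ≥0∞} [Fact (1 ≤ p)] {k f g : ℝ → ℝ} (hk : Integrable k)
    (hf : MemLp f p volume) (hg : MemAllLp g volume) :
    ∫ x, (∫ t, k t * f (x - t)) * g x = ∫ x, f x * ∫ t, k t * g (x + t) := by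
  have h1 := integrable_conv_pairing hk hf hg
  -- The measure preserving shear (x, t) ↦ (x + t, t) carries over the integrability of `h1`.
  have h2 : Integrable (fun z : ℝ × ℝ => k z.2 * f z.1 * g (z.1 + z.2))
      (volume.prod volume) := by
    have := (measurePreserving_add_prod (volume : Measure ℝ) (volume : Measure ℝ)
      ).integrable_comp_of_integrable h1
    simpa [Function.comp_def] using this
  calc ∫ x, (∫ t, k t * f (x - t)) * g x
      = ∫ x, ∫ t, k t * f (x - t) * g x := by simp_rw [integral_mul_const]
    _ = ∫ t, ∫ x, k t * f (x - t) * g x := integral_integral_swap h1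
    _ = ∫ t, ∫ x, k t * f x * g (x + t) := by
        congr with t
        rw [← integral_sub_right_eq_self (fun x => k t * f x * g (x + t)) t]
        simp
    _ = ∫ x, ∫ t, k t * f x * g (x + t) := (integral_integral_swap h2).symm
    _ = ∫ x, f x * ∫ t, k t * g (x + t) := by
        congr with x
        rw [← integral_const_mul]
        congr with t
        ring

end Duality

/-! ### Fractional integration on a bounded interval -/

section TruncatedKernel

variable {Ω : Opens ℝ} {e c d β σ : ℝ}

/-- The power kernel, cut off outside the ball of radius `L`. -/
def truncKernel (e β L : ℝ) : ℝ → ℝ := (Metric.ball 0 L).indicator (powKernel e β)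

theorem integrable_truncKernel (he : e = 1 ∨ e = -1) (hβ : 0 < β) (L : ℝ) :
    Integrable (truncKernel e β L) := by
  rw [truncKernel, integrable_indicator_iff Metric.isOpen_ball.measurableSet]
  exact ((locallyIntegrable_powKernel he hβ).integrableOn_isCompact
    (isCompact_closedBall 0 L)).mono_set Metric.ball_subset_closedBall

/-- Two points of Ω are less than d - c apart, so the cutoff is invisible inside Ω, and the
truncated kernel is integrable. -/
theorem powKernel_mul_eq_truncKernel_mul (he : e = 1 ∨ e = -1)
    (hΩ : ∀ x, x ∈ Ω ↔ c < e * x ∧ e * x < d) {f : ℝ → ℝ} (hf : ∀ x ∉ Ω, f x = 0) {x y : ℝ}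
    (hx : x ∈ Ω) {t : ℝ} (ht : |t| = |x - y|) :
    powKernel e β t * f y = truncKernel e β (d - c) t * f y := by
  by_cases h : t ∈ Metric.ball (0 : ℝ) (d - c)
  · rw [truncKernel, indicator_of_mem h]
  · rw [hf y, mul_zero, mul_zero]
    intro hy
    rw [hΩ] at hx hy
    rw [mem_ball_zero_iff, Real.norm_eq_abs, ht, abs_lt] at h
    refine h ?_
    rcases he with rfl | rfl <;> constructor <;> linarith [hx.1, hx.2, hy.1, hy.2]

theorem powConv_eq_integral_truncKernel (he : e = 1 ∨ e = -1)
    (hΩ : ∀ x, x ∈ Ω ↔ c < e * x ∧ e * x < d) {f : ℝ → ℝ} (hf : ∀ x ∉ Ω, f x = 0) {x : ℝ}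
    (hx : x ∈ Ω) : powConv e β f x = ∫ t, truncKernel e β (d - c) t * f (x - t) := by
  rw [powConv_apply]
  congr with t
  exact powKernel_mul_eq_truncKernel_mul he hΩ hf hx (by rw [sub_sub_cancel])

theorem powConv_neg_eq_integral_truncKernel (he : e = 1 ∨ e = -1)
    (hΩ : ∀ x, x ∈ Ω ↔ c < e * x ∧ e * x < d) {f : ℝ → ℝ} (hf : ∀ x ∉ Ω, f x = 0) {x : ℝ}
    (hx : x ∈ Ω) : powConv (-e) β f x = ∫ t, truncKernel e β (d - c) t * f (x + t) := by
  rw [powConv_apply, ← integral_neg_eq_self]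
  congr with t
  rw [powKernel_neg, neg_neg, sub_neg_eq_add]
  exact powKernel_mul_eq_truncKernel_mul he hΩ hf hx (by rw [sub_add_cancel_left, abs_neg])

/-- Fractional integration by parts. -/
theorem setIntegral_mul_powConv_neg (he : e = 1 ∨ e = -1)
    (hΩ : ∀ x, x ∈ Ω ↔ c < e * x ∧ e * x < d) (hσ : 0 < σ) {f ψ : ℝ → ℝ} (hfi : Integrable f)
    (hf : ∀ x ∉ Ω, f x = 0) (hψ : IsTestFunction Ω ψ) :
    ∫ x in (Ω : Set ℝ), f x * powConv (-e) σ ψ x = ∫ x in (Ω : Set ℝ), powConv e σ f x * ψ x := by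
  have h := integral_conv_mul (integrable_truncKernel he hσ (d - c))
    (memLp_one_iff_integrable.2 hfi)
    (MemAllLp.of_hasCompactSupport hψ.smooth.continuous hψ.compact)
  rw [← hψ.setIntegral_mul_eq, ← setIntegral_eq_integral_of_forall_compl_eq_zero
    (s := (Ω : Set ℝ)) (f := fun x => f x * _) (fun x hx => by rw [hf x hx, zero_mul])] at h
  rw [setIntegral_congr_fun Ω.isOpen.measurableSet fun x hx => by
      rw [powConv_neg_eq_integral_truncKernel he hΩ (fun y hy => hψ.eq_zero hy) hx], ← h]
  refine setIntegral_congr_fun Ω.isOpen.measurableSet fun x hx => ?_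
  rw [powConv_eq_integral_truncKernel he hΩ hf hx]

/-- Turns fractional weak derivatives of f into ordinary weak derivatives of order m + 1 of its
fractional integral. The minus sign is that of the opposite direction. -/
theorem setIntegral_mul_rlDeriv {s : Side}
    (hΩ : ∀ x, x ∈ Ω ↔ c < s.sign * x ∧ s.sign * x < d) (α : ℝ) {f φ : ℝ → ℝ}
    (hfi : IntegrableOn f Ω) (hφ : IsTestFunction Ω φ) :
    ∫ x in (Ω : Set ℝ), f x * rlDeriv s.opp α φ x =
      -(s.sign * (Real.Gamma (coOrder α))⁻¹) * ∫ x in (Ω : Set ℝ),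
        powConv s.sign (coOrder α) ((Ω : Set ℝ).indicator f) x *
          iteratedDeriv (⌊α⌋₊ + 1) φ x := by
  rw [← setIntegral_mul_powConv_neg s.sign_eq hΩ (coOrder_pos α)
    ((integrable_indicator_iff Ω.isOpen.measurableSet).2 hfi)
    (fun x hx => indicator_of_notMem hx _) (hφ.iteratedDeriv _), ← integral_const_mul]
  refine setIntegral_congr_fun Ω.isOpen.measurableSet fun x hx => ?_
  simp only [rlDeriv_eq hφ, Side.sign_opp, indicator_of_mem hx]
  ring

theorem powConv_eq_zero_of_le {f : ℝ → ℝ} (hf : ∀ x, e * x ≤ c → f x = 0) {x : ℝ}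
    (hx : e * x ≤ c) : powConv e β f x = 0 := by
  rw [powConv_apply]
  refine integral_eq_zero_of_ae (Eventually.of_forall fun t => ?_)
  by_cases h : 0 < e * t
  · simp [hf (x - t) (by rw [mul_sub]; linarith)]
  · simp [powKernel_of_nonpos (not_lt.1 h)]

/-- Only points before x contribute: they never reach the far end of Ω, and before the near end f is
zero. -/
theorem powConv_indicator (hΩ : ∀ x, x ∈ Ω ↔ c < e * x ∧ e * x < d) {f : ℝ → ℝ}
    (hf : ∀ x, e * x ≤ c → f x = 0) {x : ℝ} (hx : x ∈ Ω) :
    powConv e β ((Ω : Set ℝ).indicator f) x = powConv e β f x := by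
  rw [powConv_apply, powConv_apply]
  congr with t
  by_cases ht : 0 < e * t
  · by_cases h : x - t ∈ (Ω : Set ℝ)
    · rw [indicator_of_mem h]
    · rw [indicator_of_notMem h, hf]
      by_contra hlt
      refine h ((hΩ _).2 ⟨not_le.1 hlt, ?_⟩)
      have := ((hΩ x).1 hx).2
      rw [mul_sub]
      linarith
  · rw [powKernel_of_nonpos (not_lt.1 ht), zero_mul, zero_mul]

theorem subset_closedBall_of_mem_iff (he : e = 1 ∨ e = -1)
    (hΩ : ∀ x, x ∈ Ω ↔ c < e * x ∧ e * x < d) :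
    (Ω : Set ℝ) ⊆ Metric.closedBall 0 (|c| + |d|) := by
  intro x hx
  have h := (hΩ x).1 hx
  rw [mem_closedBall_zero_iff, Real.norm_eq_abs, abs_le]
  have h1 := neg_abs_le c
  have h2 := le_abs_self d
  have h3 := abs_nonneg c
  have h4 := abs_nonneg d
  rcases he with rfl | rfl <;> constructor <;> linarith [h.1, h.2]

theorem volume_lt_top_of_mem_iff (he : e = 1 ∨ e = -1)
    (hΩ : ∀ x, x ∈ Ω ↔ c < e * x ∧ e * x < d) : volume (Ω : Set ℝ) < ⊤ :=
  (measure_mono (subset_closedBall_of_mem_iff he hΩ)).trans_lt measure_closedBall_lt_top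

theorem Continuous.memLp_restrict_of_mem_iff (he : e = 1 ∨ e = -1)
    (hΩ : ∀ x, x ∈ Ω ↔ c < e * x ∧ e * x < d) {f : ℝ → ℝ} (hf : Continuous f) (p : ℝ≥0∞) :
    MemLp f p (volume.restrict (Ω : Set ℝ)) := by
  have : IsFiniteMeasure (volume.restrict (Ω : Set ℝ)) :=
    ⟨by simpa using volume_lt_top_of_mem_iff he hΩ⟩
  obtain ⟨C, hC⟩ := (isCompact_closedBall (0 : ℝ) (|c| + |d|)).exists_bound_of_continuousOn
    hf.continuousOn
  exact MemLp.of_bound hf.aestronglyMeasurable C ((ae_restrict_mem Ω.isOpen.measurableSet).mono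
    fun x hx => hC x (subset_closedBall_of_mem_iff he hΩ hx))

end TruncatedKernel

/-! ### Fractional potentials of test functions -/

section Potentials

variable {Ω : Opens ℝ} {e c d α β : ℝ} {p : ℝ≥0∞} [Fact (1 ≤ p)]

/-- The composition of orders β and 1 applied to g' is computed twice, by the semigroup law and by
the fundamental theorem. -/
theorem powConv_deriv (he : e = 1 ∨ e = -1) (hβ : 0 < β) {g : ℝ → ℝ} (hg : ContDiff ℝ ∞ g)
    (hc : HasCompactSupport g) :
    powConv e (β + 1) (deriv g) = fun x => e / betaConst β 1 * powConv e β g x := by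
  have h := powConv_powConv he hβ one_pos (hg.continuous_deriv (by simp)) hc.deriv
  rw [powConv_one_deriv he hg hc, powConv_const_mul] at h
  ext x
  have hx := congrFun h x
  have := betaConst_pos hβ one_pos
  field_simp
  linarith

/-- The fractional potential of order `β ≥ 0`, the identity for `β = 0`. -/
def fracPot (e β : ℝ) (f : ℝ → ℝ) : ℝ → ℝ := if β = 0 then f else powConv e β f

/-- Each derivative lowers the order of the potential by one. If α = k the order reaches zero, which
is why `fracPot` includes the identity. -/
theorem exists_powConv_iteratedDeriv (he : e = 1 ∨ e = -1) (k : ℕ) (hα : 0 < α) (hk : k ≤ α) :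
    ∃ κ : ℝ, κ ≠ 0 ∧ ∀ f : ℝ → ℝ, ContDiff ℝ ∞ f → HasCompactSupport f →
      powConv e α (iteratedDeriv k f) = fun x => κ * fracPot e (α - k) f x := by
  induction k generalizing α with
  | zero =>
    refine ⟨1, one_ne_zero, fun f _ _ => ?_⟩
    simp [fracPot, hα.ne']
  | succ k ih =>
    have he0 : e ≠ 0 := by rcases he with rfl | rfl <;> norm_num
    push_cast at hk ⊢
    rcases eq_or_lt_of_le (show 1 ≤ α by linarith [k.cast_nonneg (α := ℝ)]) with rfl | h1
    · have hk0 : k = 0 := by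
        have : (k : ℝ) ≤ 0 := by linarith
        exact_mod_cast le_antisymm this k.cast_nonneg
      subst hk0
      refine ⟨e, he0, fun f hf hc => ?_⟩
      simp [fracPot, powConv_one_deriv he hf hc]
    · obtain ⟨κ, hκ, h⟩ := ih (α := α - 1) (by linarith) (by linarith)
      refine ⟨e / betaConst (α - 1) 1 * κ, mul_ne_zero (div_ne_zero he0
        (betaConst_pos (by linarith) one_pos).ne') hκ, fun f hf hc => ?_⟩
      have hT : IsTestFunction ⊤ f := ⟨hf, hc, subset_univ _⟩
      have h2 := powConv_deriv he (β := α - 1) (by linarith) (hT.iteratedDeriv k).smooth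
        (hT.iteratedDeriv k).compact
      rw [sub_add_cancel, h f hf hc] at h2
      rw [iteratedDeriv_succ, h2]
      ext x
      rw [show α - (k + 1 : ℝ) = α - 1 - k by ring]
      ring

theorem norm_extendLp (f : LpOn p Ω) : ‖extendLp f‖ = ‖f‖ := by
  rw [extendLp, Lp.norm_toLp, eLpNorm_indicator_eq_eLpNorm_restrict Ω.isOpen.measurableSet]
  rfl

theorem extendLp_ae_eq {V : LpOn p Ω} {v : ℝ → ℝ} (hv : ∀ x ∉ Ω, v x = 0)
    (hV : V =ᵐ[volume.restrict (Ω : Set ℝ)] v) : extendLp V =ᵐ[volume] v := by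
  filter_upwards [coeFn_extendLp V, (ae_restrict_iff' Ω.isOpen.measurableSet).1 hV] with x h1 h2
  rw [h1]
  by_cases hx : x ∈ (Ω : Set ℝ)
  · rw [indicator_of_mem hx, h2 hx]
  · rw [indicator_of_notMem hx, hv x hx]

/-- Fractional potentials are bounded operators on `L^p` of a bounded interval. -/
theorem exists_norm_fracPot_le (hp : p ≠ ⊤) (he : e = 1 ∨ e = -1)
    (hΩ : ∀ x, x ∈ Ω ↔ c < e * x ∧ e * x < d) (hβ : 0 ≤ β) :
    ∃ C : ℝ, ∀ (v : ℝ → ℝ) (V w : LpOn p Ω), (∀ x ∉ Ω, v x = 0) →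
      V =ᵐ[volume.restrict (Ω : Set ℝ)] v →
      w =ᵐ[volume.restrict (Ω : Set ℝ)] fracPot e β v → ‖w‖ ≤ C * ‖V‖ := by
  rcases hβ.eq_or_lt with rfl | hβ
  · refine ⟨1, fun v V w _ hV hw => ?_⟩
    rw [fracPot, if_pos rfl] at hw
    rw [Lp.ext (hw.trans hV.symm), one_mul]
  · have hk := integrable_truncKernel he hβ (d - c)
    refine ⟨∫ t, ‖truncKernel e β (d - c) t‖, fun v V w hv hV hw => ?_⟩
    rw [fracPot, if_neg hβ.ne'] at hw
    -- On Ω the potential is convolution with an integrable kernel, so its norm is at most the `L^1`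
    -- norm of the kernel times that of V.
    have hw' : w = restrictLp p Ω (lpConv (truncKernel e β (d - c)) (extendLp V)) := by
      refine Lp.ext (hw.trans ?_)
      filter_upwards [ae_restrict_mem Ω.isOpen.measurableSet, coeFn_restrictLp (Ω := Ω)
        (lpConv (truncKernel e β (d - c)) (extendLp V)),
        ae_restrict_of_ae (coeFn_lpConv hp hk (extendLp V))] with x hx h1 h2
      rw [h1, h2, powConv_eq_integral_truncKernel he hΩ hv hx]
      refine integral_congr_ae ?_
      have h3 := (quasiMeasurePreserving_sub_left_of_right_invariant
        (volume : Measure ℝ) x).ae (extendLp_ae_eq hv hV)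
      filter_upwards [h3] with t ht
      rw [ht]
    rw [hw', ← norm_extendLp V]
    exact (norm_restrictLp_le _).trans (norm_lpConv_le _)

theorem Nat.cast_le_of_fin_floor (hα : 0 < α) (k : Fin (⌊α⌋₊ + 1)) : ((k : ℕ) : ℝ) ≤ α :=
  (Nat.cast_le.2 (Nat.lt_succ_iff.1 k.2)).trans (Nat.floor_le hα.le)

/-- Test functions are weak fractional derivatives of smooth functions. -/
theorem FracSobolev.exists_potential {s : Side} (hα : 0 < α)
    (hΩ : ∀ x, x ∈ Ω ↔ c < s.sign * x ∧ s.sign * x < d) :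
    ∃ (C₀ : ℝ) (κ : Fin (⌊α⌋₊ + 1) → ℝ), ∀ v, IsTestFunction Ω v →
      ∃ U ∈ FracSobolev.smoothPart s α p Ω,
        (∀ k, weakDeriv k U =ᵐ[volume.restrict (Ω : Set ℝ)]
          fun x => C₀ * (κ k * fracPot s.sign (α - (k : ℕ)) v x)) ∧
        weakFracDeriv U =ᵐ[volume.restrict (Ω : Set ℝ)] v := by
  set e := s.sign with he_def
  have he : e = 1 ∨ e = -1 := s.sign_eq
  have he0 : e ≠ 0 := by rcases he with h | h <;> rw [h] <;> norm_num
  have hσ := coOrder_pos α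
  set n := ⌊α⌋₊ + 1 with hn
  have hsum : coOrder α + α = n := coOrder_add α
  choose κ hκ hκ' using fun k : Fin n =>
    exists_powConv_iteratedDeriv he (k : ℕ) hα (Nat.cast_le_of_fin_floor hα k)
  obtain ⟨μ, hμ, hμ'⟩ := exists_powConv_iteratedDeriv he n (α := n) (by positivity) le_rfl
  have hB := betaConst_pos hσ hα
  have hΓ := Real.Gamma_pos_of_pos hσ
  -- The factor by which D^α maps `powConv e α v` to v: direction and Gamma normalization, the
  -- semigroup constant, and μ from n derivatives of the potential of order n.
  set D : ℝ := e * (Real.Gamma (coOrder α))⁻¹ * betaConst (coOrder α) α * μ with hD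
  have hD0 : D ≠ 0 := by positivity
  refine ⟨D⁻¹, κ, fun v hv => ?_⟩
  have hv0 : ∀ x, e * x ≤ c → v x = 0 := fun x hx =>
    hv.eq_zero fun h => absurd ((hΩ x).1 h).1 (not_lt.2 hx)
  let f : ℝ → ℝ := fun x => D⁻¹ * powConv e α v x
  have hf : ContDiff ℝ ∞ f := contDiff_const.mul (contDiff_powConv he hα hv.smooth hv.compact)
  have hf0 : ∀ x, e * x ≤ c → f x = 0 := fun x hx => by
    simp only [f]
    rw [powConv_eq_zero_of_le hv0 hx, mul_zero]
  have hfp : MemLp f p (volume.restrict (Ω : Set ℝ)) :=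
    hf.continuous.memLp_restrict_of_mem_iff he hΩ p
  have hf1 : IntegrableOn f Ω :=
    memLp_one_iff_integrable.1 (hf.continuous.memLp_restrict_of_mem_iff he hΩ 1)
  have hfk : ∀ k, Continuous (iteratedDeriv k f) := fun k =>
    hf.continuous_iteratedDeriv k (by exact_mod_cast le_top)
  have hfkp : ∀ k, MemLp (iteratedDeriv k f) p (volume.restrict (Ω : Set ℝ)) := fun k =>
    (hfk k).memLp_restrict_of_mem_iff he hΩ p
  have hvp : MemLp v p (volume.restrict (Ω : Set ℝ)) :=
    hv.smooth.continuous.memLp_restrict_of_mem_iff he hΩ p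
  have hw : ∀ k : Fin n, HasWeakDeriv Ω k (hfp.toLp f) ((hfkp k).toLp _) := fun k =>
    (hasWeakDeriv_iteratedDeriv hf.contDiffOn k).congr hfp.coeFn_toLp.symm
      (hfkp k).coeFn_toLp.symm (LpOn.locallyIntegrableOn Fact.out _)
  have hfrac : HasWeakFracDeriv s α Ω f v := by
    refine ⟨hv.smooth.continuous.locallyIntegrable.locallyIntegrableOn _, fun φ hφ =>
      ⟨(hφ.memAllLp_rlDeriv s.opp hα).integrable_mul hfp, ?_⟩⟩
    rw [setIntegral_mul_rlDeriv hΩ α hf1 hφ]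
    have e1 : ∀ x ∈ (Ω : Set ℝ), powConv e (coOrder α) ((Ω : Set ℝ).indicator f) x *
        iteratedDeriv n φ x = D⁻¹ * betaConst (coOrder α) α *
          (powConv e n v x * iteratedDeriv n φ x) := by
      intro x hx
      -- As f vanishes before Ω, the cut to Ω is harmless and the orders add up to σ + α = n.
      rw [powConv_indicator hΩ hf0 hx]
      simp only [f]
      rw [powConv_const_mul, powConv_powConv he hσ hα hv.smooth.continuous hv.compact, hsum]
      ring
    rw [setIntegral_congr_fun Ω.isOpen.measurableSet e1, integral_const_mul]
    have h1 := ((hasWeakDeriv_iteratedDeriv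
      (contDiff_powConv he (β := n) (by positivity) hv.smooth hv.compact).contDiffOn n).2 φ hφ).2
    rw [iteratedDeriv_powConv he (by positivity) hv.smooth hv.compact,
      hμ' v hv.smooth hv.compact] at h1
    simp only [fracPot, sub_self, if_true, mul_assoc] at h1
    rw [integral_const_mul] at h1
    -- Since n = m + 1, this sign cancels the minus sign of `setIntegral_mul_rlDeriv`.
    have hs : (-1 : ℝ) ^ ⌊α⌋₊ * (-1) ^ n = -1 := by
      rw [hn, pow_succ, ← mul_assoc, ← mul_pow]; simp
    have hs2 : (-1 : ℝ) ^ n * (-1) ^ n = 1 := by rw [← mul_pow]; simp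
    have h2 : ∫ x in (Ω : Set ℝ), powConv e n v x * iteratedDeriv n φ x =
        (-1) ^ n * (μ * ∫ x in (Ω : Set ℝ), v x * φ x) := by
      rw [h1, ← mul_assoc, hs2, one_mul]
    rw [h2]
    have h3 : D⁻¹ * (e * (Real.Gamma (coOrder α))⁻¹ * betaConst (coOrder α) α * μ) = 1 :=
      inv_mul_cancel₀ hD0
    rw [← he_def]
    generalize D⁻¹ = E at h3 ⊢
    linear_combination (E * (e * (Real.Gamma (coOrder α))⁻¹ * betaConst (coOrder α) α * μ) *
      ∫ x in (Ω : Set ℝ), v x * φ x) * hs - (∫ x in (Ω : Set ℝ), v x * φ x) * h3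
  obtain ⟨U, hU0, hUk, hUf⟩ := exists_of_hasWeakDeriv hw (hfrac.congr hfp.coeFn_toLp.symm
    hvp.coeFn_toLp.symm (LpOn.locallyIntegrableOn Fact.out _))
  refine ⟨U, ⟨f, hf.contDiffOn, by rw [hU0]; exact hfp.coeFn_toLp⟩, fun k => ?_,
    by rw [hUf]; exact hvp.coeFn_toLp⟩
  rw [hUk]
  refine (hfkp k).coeFn_toLp.trans (Eventually.of_forall fun x => ?_)
  simp only [f]
  rw [iteratedDeriv_const_mul_field, iteratedDeriv_powConv he hα hv.smooth hv.compact,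
    hκ' k v hv.smooth hv.compact]

end Potentials

/-! ### Density of test functions in `L^p` of an interval -/

section TestFunctionsDense

variable {Ω : Opens ℝ} {a b : ℝ} {p : ℝ≥0∞} [Fact (1 ≤ p)]

/-- Smooth cutoff functions on a bounded interval. -/
def intervalCutoff (hab : a < b) (n : ℕ) : ContDiffBump ((a + b) / 2) where
  rIn := (b - a) / 2 * (1 - 1 / ((n : ℝ) + 2))
  rOut := (b - a) / 2 * (1 - 1 / ((n : ℝ) + 3))
  rIn_pos := by
    have h : 1 / ((n : ℝ) + 2) < 1 := by
      rw [div_lt_one (by positivity)]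
      linarith [n.cast_nonneg (α := ℝ)]
    exact mul_pos (by linarith) (by linarith)
  rIn_lt_rOut := by
    have h : 1 / ((n : ℝ) + 3) < 1 / ((n : ℝ) + 2) :=
      one_div_lt_one_div_of_lt (by positivity) (by linarith)
    exact mul_lt_mul_of_pos_left (by linarith) (by linarith)

theorem isTestFunction_intervalCutoff_mul (hab : a < b) (hΩ : (Ω : Set ℝ) = Ioo a b) (n : ℕ)
    {g : ℝ → ℝ} (hg : ContDiff ℝ ∞ g) : IsTestFunction Ω fun x => intervalCutoff hab n x * g x := by
  refine ⟨(intervalCutoff hab n).contDiff.mul hg, (intervalCutoff hab n).hasCompactSupport.mul_right,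
    (tsupport_mul_subset_left).trans ?_⟩
  rw [(intervalCutoff hab n).tsupport_eq, hΩ, Real.closedBall_eq_Icc]
  have h : 0 < (b - a) / 2 * (1 / ((n : ℝ) + 3)) := mul_pos (by linarith) (by positivity)
  intro x hx
  have h1 := hx.1
  have h2 := hx.2
  simp only [intervalCutoff] at h1 h2
  constructor <;> linarith

theorem tendsto_intervalCutoff (hab : a < b) {x : ℝ} (hx : x ∈ Ioo a b) :
    Tendsto (fun n => intervalCutoff hab n x) atTop (𝓝 1) := by
  have h1 : Tendsto (fun n : ℕ => (b - a) / 2 * (1 - 1 / ((n : ℝ) + 2))) atTop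
      (𝓝 ((b - a) / 2 * (1 - 0))) := by
    refine (tendsto_const_nhds.sub ?_).const_mul _
    refine ((tendsto_one_div_add_atTop_nhds_zero_nat (𝕜 := ℝ)).comp (tendsto_add_atTop_nat 1)).congr
      fun n => ?_
    simp only [Function.comp_apply]
    push_cast
    rw [add_assoc]
    norm_num
  have h2 : dist x ((a + b) / 2) < (b - a) / 2 * (1 - 0) := by
    rw [Real.dist_eq, abs_lt]
    constructor <;> linarith [hx.1, hx.2]
  refine tendsto_const_nhds.congr' ?_
  filter_upwards [h1.eventually (lt_mem_nhds h2)] with n hn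
  exact ((intervalCutoff hab n).one_of_mem_closedBall hn.le).symm

/-- Compactly supported smooth functions on the line are dense for the restricted measure, but their
supports may leave Ω. Cutoffs tending to 1 inside Ω repair this. -/
theorem dense_testFunctions (hp : p ≠ ⊤) (hab : a < b) (hΩ : (Ω : Set ℝ) = Ioo a b) :
    Dense {V : LpOn p Ω | ∃ v, IsTestFunction Ω v ∧ V =ᵐ[volume.restrict (Ω : Set ℝ)] v} := by
  have hfin : IsFiniteMeasure (volume.restrict (Ω : Set ℝ)) := ⟨by simp [hΩ]⟩
  refine dense_closure.1 ((Lp.dense_hasCompactSupport_contDiff (F := ℝ)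
    (μ := volume.restrict (Ω : Set ℝ)) hp).mono ?_)
  rintro V ⟨g, hVg, hgc, hg⟩
  have hgp : MemLp g p (volume.restrict (Ω : Set ℝ)) :=
    hg.continuous.memLp_of_hasCompactSupport hgc
  have hV : V = hgp.toLp g := Lp.ext (hVg.trans hgp.coeFn_toLp.symm)
  have hle : ∀ n x, ‖intervalCutoff hab n x * g x‖ ≤ ‖g x‖ := fun n x => by
    rw [norm_mul, Real.norm_of_nonneg (intervalCutoff hab n).nonneg]
    exact mul_le_of_le_one_left (norm_nonneg _) (intervalCutoff hab n).le_one
  have hmeas : ∀ n, AEStronglyMeasurable (fun x => intervalCutoff hab n x * g x)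
      (volume.restrict (Ω : Set ℝ)) := fun n =>
    ((intervalCutoff hab n).continuous.mul hg.continuous).aestronglyMeasurable
  have hgn : ∀ n, MemLp (fun x => intervalCutoff hab n x * g x) p
      (volume.restrict (Ω : Set ℝ)) := fun n =>
    hgp.mono (hmeas n) (Eventually.of_forall (hle n))
  -- Vitali's theorem on a finite measure; uniform integrability comes from the common majorant |g|.
  have hlim := tendsto_Lp_finite_of_tendsto_ae (μ := volume.restrict (Ω : Set ℝ)) (p := p)
    Fact.out hp (f := fun n x => intervalCutoff hab n x * g x) (g := g) hmeas hgp (by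
      intro ε hε
      obtain ⟨δ, hδ, h⟩ := hgp.eLpNorm_indicator_le Fact.out hp hε
      refine ⟨δ, hδ, fun n s hs hμs => (eLpNorm_mono fun x => ?_).trans (h s hs hμs)⟩
      by_cases hx : x ∈ s
      · simpa only [indicator_of_mem hx] using hle n x
      · simp [hx]) (by
      filter_upwards [ae_restrict_mem Ω.isOpen.measurableSet] with x hx
      rw [hΩ] at hx
      simpa using (tendsto_intervalCutoff hab hx).mul_const (g x))
  rw [hV]
  refine mem_closure_of_tendsto (b := atTop) (f := fun n => (hgn n).toLp _)
    ((Lp.tendsto_Lp_iff_tendsto_eLpNorm'' _ hgn g hgp).2 hlim) (Eventually.of_forall fun n =>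
      ⟨_, isTestFunction_intervalCutoff_mul hab hΩ n hg, (hgn n).coeFn_toLp⟩)

end TestFunctionsDense

/-! ### Surjectivity of the fractional derivative from the closure of smooth functions -/

section BoundedInterval

variable {Ω : Opens ℝ} {c d α : ℝ} {s : Side} {p : ℝ≥0∞} [Fact (1 ≤ p)]

theorem exists_eq_Ioo {e : ℝ} (he : e = 1 ∨ e = -1) (hcd : c < d)
    (hΩ : ∀ x, x ∈ Ω ↔ c < e * x ∧ e * x < d) :
    ∃ a b, a < b ∧ (Ω : Set ℝ) = Ioo a b := by
  rcases he with rfl | rfl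
  · refine ⟨c, d, hcd, ?_⟩
    ext x
    rw [SetLike.mem_coe, hΩ]
    simp
  · refine ⟨-d, -c, by linarith, ?_⟩
    ext x
    rw [SetLike.mem_coe, hΩ, mem_Ioo]
    constructor <;> rintro ⟨h1, h2⟩ <;> constructor <;> linarith

theorem cauchySeq_of_dist_le_mul {X Y : Type*} [PseudoMetricSpace X] [PseudoMetricSpace Y]
    {f : ℕ → X} {g : ℕ → Y} {C : ℝ} (hg : CauchySeq g)
    (h : ∀ m n, dist (f m) (f n) ≤ C * dist (g m) (g n)) : CauchySeq f := by
  rw [cauchySeq_iff_tendsto_dist_atTop_0] at hg ⊢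
  refine squeeze_zero (fun _ => dist_nonneg) (fun n => h n.1 n.2) ?_
  simpa using hg.const_mul C

theorem fracPot_sub {e β : ℝ} (he : e = 1 ∨ e = -1) (hβ : 0 ≤ β) {v w : ℝ → ℝ}
    (hv : IsTestFunction Ω v) (hw : IsTestFunction Ω w) (x : ℝ) :
    fracPot e β (fun y => v y - w y) x = fracPot e β v x - fracPot e β w x := by
  unfold fracPot
  split_ifs with h
  · rfl
  · have hβ' : 0 < β := lt_of_le_of_ne hβ (Ne.symm h)
    have h1 : Integrable fun t => powKernel e β t * v (x - t) :=
      convolutionExists_powKernel he hβ' hv.smooth.continuous hv.compact x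
    have h2 : Integrable fun t => powKernel e β t * w (x - t) :=
      convolutionExists_powKernel he hβ' hw.smooth.continuous hw.compact x
    simp_rw [powConv_apply, mul_sub]
    exact integral_sub h1 h2

/-- On a bounded interval, every function in `L^p` is the weak fractional derivative of a limit of
smooth functions. -/
theorem FracSobolev.exists_mem_closure_weakFracDeriv_eq (hp : p ≠ ⊤) (hα : 0 < α) (hcd : c < d)
    (hΩ : ∀ x, x ∈ Ω ↔ c < s.sign * x ∧ s.sign * x < d) (V : LpOn p Ω) :
    ∃ U ∈ closure (FracSobolev.smoothPart s α p Ω : Set (FracSobolev s α p Ω)),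
      weakFracDeriv U = V := by
  obtain ⟨a, b, hab, hΩab⟩ := exists_eq_Ioo s.sign_eq hcd hΩ
  obtain ⟨Vn, hVn, hlim⟩ := mem_closure_iff_seq_limit.1 (dense_testFunctions hp hab hΩab V)
  choose v hv hVv using hVn
  obtain ⟨C₀, κ, hpot⟩ := exists_potential (p := p) hα hΩ
  choose U hUs hUk hUf using fun n => hpot (v n) (hv n)
  have hUf' : ∀ n, weakFracDeriv (U n) = Vn n := fun n => Lp.ext ((hUf n).trans (hVv n).symm)
  have hcau : ∀ k, CauchySeq fun n => weakDeriv k (U n) := by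
    intro k
    have hβ : 0 ≤ α - (k : ℕ) := sub_nonneg.2 (Nat.cast_le_of_fin_floor hα k)
    obtain ⟨C, hC⟩ := exists_norm_fracPot_le (p := p) hp s.sign_eq hΩ hβ
    refine cauchySeq_of_dist_le_mul (C := |C₀ * κ k| * C) hlim.cauchySeq fun m n => ?_
    have hmn : IsTestFunction Ω fun y => v m y - v n y :=
      ⟨(hv m).smooth.sub (hv n).smooth, (hv m).compact.sub (hv n).compact,
        (tsupport_sub (v m) (v n)).trans (union_subset (hv m).support (hv n).support)⟩
    -- The potential of v m - v n has the differences as its weak derivatives, so the operator bound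
    -- for `fracPot` controls them by Vn m - Vn n.
    obtain ⟨W, -, hWk, hWf⟩ := hpot _ hmn
    have hW : (weakDeriv k (U m) - weakDeriv k (U n) : LpOn p Ω) = weakDeriv k W := by
      refine Lp.ext ((Lp.coeFn_sub _ _).trans ?_)
      filter_upwards [hUk m k, hUk n k, hWk k] with x h1 h2 h3
      rw [Pi.sub_apply, h1, h2, h3, fracPot_sub s.sign_eq hβ (hv m) (hv n)]
      ring
    have hWV : (Vn m - Vn n : LpOn p Ω) =ᵐ[volume.restrict (Ω : Set ℝ)] fun y => v m y - v n y :=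
      (Lp.coeFn_sub _ _).trans ((hVv m).sub (hVv n))
    rw [dist_eq_norm, dist_eq_norm, hW]
    rcases eq_or_ne (C₀ * κ k) 0 with h0 | h0
    · have : weakDeriv k W = 0 := by
        refine Lp.ext ((hWk k).trans (EventuallyEq.trans ?_ (Lp.coeFn_zero ..).symm))
        refine Eventually.of_forall fun x => ?_
        simp only [← mul_assoc, h0, zero_mul, Pi.zero_apply]
      rw [this, h0]
      simp
    -- The bound concerns the bare potential, so the factor C₀ κ k is divided out first.
    · have hCW := hC _ (Vn m - Vn n) ((C₀ * κ k)⁻¹ • weakDeriv k W) (fun x hx => hmn.eq_zero hx)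
        hWV (by
          filter_upwards [Lp.coeFn_smul (C₀ * κ k)⁻¹ (weakDeriv k W), hWk k] with x h1 h2
          rw [h1, Pi.smul_apply, h2, smul_eq_mul, ← mul_assoc C₀, inv_mul_cancel_left₀ h0])
      rw [norm_smul, norm_inv, Real.norm_eq_abs, inv_mul_le_iff₀ (abs_pos.2 h0)] at hCW
      rwa [mul_assoc]
  choose w hw using fun k => cauchySeq_tendsto_of_complete (hcau k)
  obtain ⟨U₀, hU₀, -, hU₀f⟩ := exists_of_tendsto (u := U) hα hw (v := V) (by simpa only [hUf'])
  exact ⟨U₀, mem_closure_of_tendsto hU₀ (Eventually.of_forall hUs), hU₀f⟩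

end BoundedInterval

/-! ### Smoothness of the kernel of the fractional derivative -/

section Kernel

variable {Ω : Opens ℝ} {e c d σ τ : ℝ}

/-- Where both factors are nonzero, e r and e (t - r) are positive with sum e t < L, so neither
truncation is felt. -/
theorem convolution_truncKernel (he : e = 1 ∨ e = -1) {L t : ℝ} (ht : |t| < L) :
    ∫ r, truncKernel e τ L r * truncKernel e σ L (t - r) =
      betaConst τ σ * powKernel e (τ + σ) t := by
  rw [← integral_powKernel_mul_powKernel he]
  congr with r
  by_cases h1 : 0 < e * r
  · by_cases h2 : 0 < e * (t - r)
    · have h3 := abs_lt.1 ht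
      have hr : r ∈ Metric.ball (0 : ℝ) L := by
        rw [mem_ball_zero_iff, Real.norm_eq_abs, abs_lt]
        rcases he with rfl | rfl <;> constructor <;> linarith
      have htr : t - r ∈ Metric.ball (0 : ℝ) L := by
        rw [mem_ball_zero_iff, Real.norm_eq_abs, abs_lt]
        rcases he with rfl | rfl <;> constructor <;> linarith
      rw [truncKernel, truncKernel, indicator_of_mem hr, indicator_of_mem htr]
    · have h0 := powKernel_of_nonpos (β := σ) (not_lt.1 h2)
      have h0' : truncKernel e σ L (t - r) = 0 := by simp [truncKernel, h0]
      rw [h0, h0', mul_zero, mul_zero]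
  · have h0 := powKernel_of_nonpos (β := τ) (not_lt.1 h1)
    have h0' : truncKernel e τ L r = 0 := by simp [truncKernel, h0]
    rw [h0, h0', zero_mul, zero_mul]

/-- Semigroup property of the fractional integrals on integrable functions. -/
theorem powConv_indicator_powConv_ae_eq (he : e = 1 ∨ e = -1)
    (hΩ : ∀ x, x ∈ Ω ↔ c < e * x ∧ e * x < d) (hσ : 0 < σ) (hτ : 0 < τ) {f : ℝ → ℝ}
    (hfi : Integrable f) (hf : ∀ x ∉ Ω, f x = 0) :
    ∀ᵐ x ∂volume.restrict (Ω : Set ℝ),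
      powConv e τ ((Ω : Set ℝ).indicator (powConv e σ f)) x =
        betaConst τ σ * powConv e (τ + σ) f x := by
  have hkσ := integrable_truncKernel he hσ (d - c)
  have hkτ := integrable_truncKernel he hτ (d - c)
  -- For merely integrable f the triple convolution exists only almost everywhere, hence the almost
  -- everywhere conclusion.
  have hassoc : ∀ᵐ x ∂(volume : Measure ℝ),
      ((truncKernel e τ (d - c) ⋆[ContinuousLinearMap.mul ℝ ℝ, volume] truncKernel e σ (d - c))
        ⋆[ContinuousLinearMap.mul ℝ ℝ, volume] f) x =
      (truncKernel e τ (d - c) ⋆[ContinuousLinearMap.mul ℝ ℝ, volume] (truncKernel e σ (d - c)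
        ⋆[ContinuousLinearMap.mul ℝ ℝ, volume] f)) x := by
    filter_upwards [hkτ.norm.ae_convolution_exists (ContinuousLinearMap.mul ℝ ℝ)
      (hkσ.norm.integrable_convolution (ContinuousLinearMap.mul ℝ ℝ) hfi.norm)] with x hx
    exact convolution_assoc _ _ _ _ (fun a b c => by simp [mul_assoc]) hkτ.1 hkσ.1 hfi.1
      (hkτ.ae_convolution_exists _ hkσ) (hkσ.norm.ae_convolution_exists _ hfi.norm) hx
  filter_upwards [ae_restrict_of_ae hassoc, ae_restrict_mem Ω.isOpen.measurableSet] with x hx hxΩ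
  have e1 : powConv e τ ((Ω : Set ℝ).indicator (powConv e σ f)) x =
      (truncKernel e τ (d - c) ⋆[ContinuousLinearMap.mul ℝ ℝ, volume] (truncKernel e σ (d - c)
        ⋆[ContinuousLinearMap.mul ℝ ℝ, volume] f)) x := by
    rw [powConv_eq_integral_truncKernel he hΩ (fun y hy => indicator_of_notMem hy _) hxΩ]
    refine integral_congr_ae (Eventually.of_forall fun t => ?_)
    beta_reduce
    rw [ContinuousLinearMap.mul_apply']
    by_cases h0 : truncKernel e τ (d - c) t = 0
    · rw [h0, zero_mul, zero_mul]
    congr 1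
    have ht : 0 < e * t := by
      by_contra ht
      exact h0 (by simp [truncKernel, powKernel_of_nonpos (not_lt.1 ht)])
    by_cases hxt : x - t ∈ (Ω : Set ℝ)
    · rw [indicator_of_mem hxt]
      exact powConv_eq_integral_truncKernel he hΩ hf hxt
    · rw [indicator_of_notMem hxt]
      -- The point x - t precedes x but is not in Ω, so it lies before the near end, and so does x -
      -- t - r; there f is zero.
      refine (integral_eq_zero_of_ae (Eventually.of_forall fun r => ?_)).symm
      by_cases hr : 0 < e * r
      · rw [ContinuousLinearMap.mul_apply', hf (x - t - r), mul_zero, Pi.zero_apply]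
        intro hmem
        refine hxt ((hΩ _).2 ?_)
        have h1 := (hΩ _).1 hmem
        have h2 := (hΩ _).1 hxΩ
        constructor <;> linarith [h1.1, h2.2, mul_sub e x t, mul_sub e (x - t) r]
      · simp [truncKernel, powKernel_of_nonpos (not_lt.1 hr)]
  rw [e1, ← hx, powConv_apply, ← integral_const_mul]
  refine integral_congr_ae (Eventually.of_forall fun t => ?_)
  beta_reduce
  rw [ContinuousLinearMap.mul_apply']
  by_cases hxt : x - t ∈ Ω
  · have ht : |t| < d - c := by
      have h1 := (hΩ _).1 hxt
      have h2 := (hΩ _).1 hxΩ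
      rw [abs_lt]
      rcases he with rfl | rfl <;> constructor <;> linarith [h1.1, h1.2, h2.1, h2.2]
    have := convolution_truncKernel (τ := τ) (σ := σ) he ht
    change (∫ r, truncKernel e τ (d - c) r * truncKernel e σ (d - c) (t - r)) * f (x - t) = _
    rw [this, mul_assoc]
  · rw [hf _ hxt]
    ring

/-- Fractional integrals of polynomials. -/
theorem exists_contDiffOn_powConv_polynomial (he : e = 1 ∨ e = -1)
    (hΩ : ∀ x, x ∈ Ω ↔ c < e * x ∧ e * x < d) (hτ : 0 < τ) (P : Polynomial ℝ) :
    ∃ S : ℝ → ℝ, ContDiffOn ℝ ∞ S Ω ∧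
      ∀ x ∈ Ω, powConv e τ ((Ω : Set ℝ).indicator fun y => P.eval y) x = S x := by
  have hee : e * e = 1 := by rcases he with rfl | rfl <;> norm_num
  -- P is re-expanded in powers of e y - c, the distance from the end where integration starts. The
  -- j-th power, cut off there, is a shifted power kernel of order j + 1, so the beta integral gives
  -- a closed form.
  let Q : Polynomial ℝ := P.comp (Polynomial.C e * (Polynomial.X + Polynomial.C c))
  have hQ : ∀ y, P.eval y = ∑ j ∈ Finset.range (Q.natDegree + 1), Q.coeff j * (e * y - c) ^ j := by
    intro y
    rw [← Polynomial.eval_eq_sum_range]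
    simp only [Q, Polynomial.eval_comp, Polynomial.eval_mul, Polynomial.eval_C,
      Polynomial.eval_add, Polynomial.eval_X, sub_add_cancel, ← mul_assoc, hee, one_mul]
  refine ⟨fun x => ∑ j ∈ Finset.range (Q.natDegree + 1),
    Q.coeff j * (betaConst τ (j + 1) * (e * x - c) ^ (τ + (j + 1) - 1)), ?_, fun x hx => ?_⟩
  · refine ContDiffOn.sum fun j _ => contDiffOn_const.mul (contDiffOn_const.mul ?_)
    -- The base e x - c is positive in the open interval; smoothness may fail at the endpoint.
    refine ContDiffOn.rpow_const_of_ne (by fun_prop) fun x hx => ?_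
    linarith [((hΩ x).1 hx).1]
  · have hxc : 0 < e * (x - e * c) := by
      rw [mul_sub, ← mul_assoc, hee]
      linarith [((hΩ x).1 hx).1]
    have hxe : e * (x - e * c) = e * x - c := by rw [mul_sub, ← mul_assoc, hee, one_mul]
    have h1 : ∀ j : ℕ, betaConst τ (j + 1) * (e * x - c) ^ (τ + (j + 1) - 1) =
        ∫ t, powKernel e τ t * powKernel e (j + 1) (x - e * c - t) := fun j => by
      rw [integral_powKernel_mul_powKernel he, powKernel_of_pos hxc, hxe]
    simp_rw [h1, ← integral_const_mul]
    rw [← integral_finsetSum _ fun j _ =>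
      (integrable_powKernel_mul_powKernel hτ (by positivity) _).const_mul _, powConv_apply]
    refine integral_congr_ae (Eventually.of_forall fun t => ?_)
    beta_reduce
    by_cases ht : 0 < e * t
    · have hker : ∀ j : ℕ, powKernel e (j + 1) (x - e * c - t) =
          if c < e * (x - t) then (e * (x - t) - c) ^ j else 0 := by
        intro j
        have h2 : e * (x - e * c - t) = e * (x - t) - c := by
          linear_combination (-c) * hee
        unfold powKernel
        rw [h2, add_sub_cancel_right, Real.rpow_natCast]
        simp only [sub_pos]
      simp_rw [hker]
      by_cases hxt : c < e * (x - t)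
      · have hmem : x - t ∈ (Ω : Set ℝ) := (hΩ _).2 ⟨hxt, by
          have := ((hΩ x).1 hx).2
          rw [mul_sub]
          linarith⟩
        rw [indicator_of_mem hmem, hQ, Finset.mul_sum]
        refine Finset.sum_congr rfl fun j _ => ?_
        rw [if_pos hxt]
        ring
      · have hmem : x - t ∉ (Ω : Set ℝ) := fun h => hxt ((hΩ _).1 h).1
        rw [indicator_of_notMem hmem]
        simp [hxt]
    · simp [powKernel_of_nonpos (not_lt.1 ht)]

/-- The integral of order one is a weak primitive of e f, so f is e times the classical derivative
of S, as e² = 1. -/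
theorem exists_contDiffOn_of_powConv_one {f : ℝ → ℝ} (he : e = 1 ∨ e = -1)
    (hΩ : ∀ x, x ∈ Ω ↔ c < e * x ∧ e * x < d) (hfi : IntegrableOn f Ω) {S : ℝ → ℝ}
    (hS : ContDiffOn ℝ ∞ S Ω)
    (h : powConv e 1 ((Ω : Set ℝ).indicator f) =ᵐ[volume.restrict (Ω : Set ℝ)] S) :
    ∃ g : ℝ → ℝ, ContDiffOn ℝ ∞ g Ω ∧ f =ᵐ[volume.restrict (Ω : Set ℝ)] g := by
  have hee : e * e = 1 := by rcases he with rfl | rfl <;> norm_num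
  have hw : HasWeakDeriv Ω 1 S fun x => e * f x := by
    refine ⟨IntegrableOn.locallyIntegrableOn (hfi.const_mul e), fun φ hφ =>
      ⟨(hφ.iteratedDeriv 1).integrable_mul hS.locallyIntegrableOn_opens, ?_⟩⟩
    have h1 := setIntegral_mul_powConv_neg he hΩ one_pos
      ((integrable_indicator_iff Ω.isOpen.measurableSet).2 hfi)
      (fun x hx => indicator_of_notMem hx _) hφ.deriv
    have he' : -e = 1 ∨ -e = -1 := by rcases he with rfl | rfl <;> norm_num
    rw [powConv_one_deriv he' hφ.smooth hφ.compact] at h1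
    have h2 : ∫ x in (Ω : Set ℝ), powConv e 1 ((Ω : Set ℝ).indicator f) x * deriv φ x =
        ∫ x in (Ω : Set ℝ), S x * deriv φ x := by
      refine integral_congr_ae ?_
      filter_upwards [h] with x hx
      rw [hx]
    rw [h2] at h1
    simp only [iteratedDeriv_one]
    rw [← h1, pow_one, ← integral_const_mul]
    refine setIntegral_congr_fun Ω.isOpen.measurableSet fun x hx => ?_
    simp only [indicator_of_mem hx]
    ring
  refine ⟨fun x => e * iteratedDeriv 1 S x,
    contDiffOn_const.mul (contDiffOn_iteratedDeriv hS 1), ?_⟩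
  filter_upwards [hw.unique (hasWeakDeriv_iteratedDeriv hS 1)] with x hx
  rw [← hx, ← mul_assoc, hee, one_mul]

/-- On a bounded interval, a function whose weak fractional derivative vanishes is smooth. -/
theorem exists_contDiffOn_of_weakFracDeriv_eq_zero {s : Side} {α : ℝ} (hα : 0 < α) (hcd : c < d)
    (hΩ : ∀ x, x ∈ Ω ↔ c < s.sign * x ∧ s.sign * x < d) {f : ℝ → ℝ} (hfi : IntegrableOn f Ω)
    (h : ∀ φ, IsTestFunction Ω φ → ∫ x in (Ω : Set ℝ), f x * rlDeriv s.opp α φ x = 0) :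
    ∃ g : ℝ → ℝ, ContDiffOn ℝ ∞ g Ω ∧ f =ᵐ[volume.restrict (Ω : Set ℝ)] g := by
  have he : s.sign = 1 ∨ s.sign = -1 := s.sign_eq
  have he0 : s.sign ≠ 0 := by rcases he with h | h <;> rw [h] <;> norm_num
  have hσ := coOrder_pos α
  have hΓ := Real.Gamma_pos_of_pos hσ
  obtain ⟨a, b, hab, hΩab⟩ := exists_eq_Ioo he hcd hΩ
  have hFi := (integrable_indicator_iff Ω.isOpen.measurableSet).2 hfi
  have hF0 : ∀ x ∉ Ω, (Ω : Set ℝ).indicator f x = 0 := fun x hx => indicator_of_notMem hx _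
  have hwi : IntegrableOn (powConv s.sign (coOrder α) ((Ω : Set ℝ).indicator f)) Ω := by
    have h1 := ((integrable_truncKernel he hσ (d - c)).integrable_convolution
      (ContinuousLinearMap.mul ℝ ℝ) hFi).integrableOn (s := (Ω : Set ℝ))
    exact h1.congr_fun (fun x hx => (powConv_eq_integral_truncKernel he hΩ hF0 hx).symm)
      Ω.isOpen.measurableSet
  obtain ⟨P, hP⟩ := exists_polynomial_of_integral_iteratedDeriv_eq_zero hab hΩab (⌊α⌋₊ + 1)
    hwi.locallyIntegrableOn fun φ hφ => by
      have h1 := h φ hφ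
      rw [setIntegral_mul_rlDeriv hΩ α hfi hφ] at h1
      exact (mul_eq_zero.1 h1).resolve_left
        (neg_ne_zero.2 (mul_ne_zero he0 (inv_pos.2 hΓ).ne'))
  -- If σ = 1, that is, α is an integer, the first-order integral is already the polynomial.
  -- Otherwise integration of the complementary order 1 - σ raises the order to one.
  rcases (coOrder_le_one hα).eq_or_lt with h1 | h1
  · rw [h1] at hP
    exact exists_contDiffOn_of_powConv_one he hΩ hfi (P.contDiff_aeval ∞).contDiffOn (by simpa using hP)
  · have hτ : 0 < 1 - coOrder α := by linarith
    have hB := betaConst_pos hτ hσ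
    obtain ⟨S, hS, hPS⟩ := exists_contDiffOn_powConv_polynomial he hΩ hτ P
    refine exists_contDiffOn_of_powConv_one he hΩ hfi (S := fun x =>
      (betaConst (1 - coOrder α) (coOrder α))⁻¹ * S x) (contDiffOn_const.mul hS) ?_
    filter_upwards [powConv_indicator_powConv_ae_eq he hΩ hσ hτ hFi hF0,
      ae_restrict_mem Ω.isOpen.measurableSet] with x hx hxΩ
    rw [sub_add_cancel] at hx
    rw [← hPS x hxΩ, eq_inv_mul_iff_mul_eq₀ hB.ne', ← hx, powConv_apply, powConv_apply]
    refine integral_congr_ae ?_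
    have h2 : (Ω : Set ℝ).indicator (powConv s.sign (coOrder α) ((Ω : Set ℝ).indicator f))
        =ᵐ[volume] (Ω : Set ℝ).indicator fun y => P.eval y := by
      filter_upwards [(ae_restrict_iff' Ω.isOpen.measurableSet).1 hP] with y hy
      by_cases hyΩ : y ∈ (Ω : Set ℝ)
      · rw [indicator_of_mem hyΩ, indicator_of_mem hyΩ, hy hyΩ]
      · rw [indicator_of_notMem hyΩ, indicator_of_notMem hyΩ]
    filter_upwards [(quasiMeasurePreserving_sub_left_of_right_invariant
      (volume : Measure ℝ) x).ae h2] with t ht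
    rw [ht]

end Kernel

/-! ### Density on bounded intervals and the theorem -/

theorem FracSobolev.dense_smoothPart_of_bounded {Ω : Opens ℝ} {c d α : ℝ} {s : Side} {p : ℝ≥0∞}
    [Fact (1 ≤ p)] (hp : p ≠ ⊤) (hα : 0 < α) (hcd : c < d)
    (hΩ : ∀ x, x ∈ Ω ↔ c < s.sign * x ∧ s.sign * x < d) :
    Dense (FracSobolev.smoothPart s α p Ω : Set (FracSobolev s α p Ω)) := by
  intro u
  obtain ⟨U, hU, hUu⟩ := exists_mem_closure_weakFracDeriv_eq hp hα hcd hΩ (weakFracDeriv u)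
  have hfin : IsFiniteMeasure (volume.restrict (Ω : Set ℝ)) :=
    ⟨by simpa using volume_lt_top_of_mem_iff s.sign_eq hΩ⟩
  have hz : weakFracDeriv (u - U) = 0 := by rw [map_sub, hUu, sub_self]
  have hw := hasWeakFracDeriv (u - U)
  rw [hz] at hw
  -- U carries the fractional derivative of u, so u - U lies in the kernel and is smooth itself.
  have hmem : u - U ∈ FracSobolev.smoothPart s α p Ω := by
    refine exists_contDiffOn_of_weakFracDeriv_eq_zero hα hcd hΩ
      (((Lp.memLp (toLp (u - U))).integrable Fact.out)) fun φ hφ => ?_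
    have h1 := (hw.2 φ hφ).2
    have h2 : ∫ x in (Ω : Set ℝ), (0 : LpOn p Ω) x * φ x = 0 := by
      refine integral_eq_zero_of_ae ?_
      filter_upwards [Lp.coeFn_zero ℝ p (volume.restrict (Ω : Set ℝ))] with x hx
      rw [hx, Pi.zero_apply, zero_mul]
    rw [h2] at h1
    exact (mul_eq_zero.1 h1.symm).resolve_left (by simp)
  have hadd := (FracSobolev.smoothPart s α p Ω).topologicalClosure.add_mem hU
    (Submodule.le_topologicalClosure _ hmem)
  rwa [add_sub_cancel] at hadd

theorem mainTheorem1 (Ω : Opens ℝ)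
    (hΩ : (∃ a b : ℝ, a < b ∧ (Ω : Set ℝ) = Ioo a b) ∨ (Ω : Set ℝ) = univ)
    (s : Side) (α : ℝ) (hα : 0 < α) (p : ℝ≥0∞) [Fact (1 ≤ p)] (hp : p ≠ ⊤) :
    (∃ Φ : CompletedFracSobolev s α p Ω ≃ₗᵢ[ℝ] FracSobolev s α p Ω,
      ∀ f : FracSobolev.smoothPart s α p Ω,
        Φ (f : CompletedFracSobolev s α p Ω) = (f : FracSobolev s α p Ω)) ∧
    Dense (FracSobolev.smoothPart s α p Ω : Set (FracSobolev s α p Ω)) := by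
  have hdense : Dense (FracSobolev.smoothPart s α p Ω : Set (FracSobolev s α p Ω)) := by
    rcases hΩ with ⟨a, b, hab, hΩ⟩ | hΩ
    · have hmem : ∀ x, x ∈ Ω ↔ a < x ∧ x < b := fun x => by
        rw [← SetLike.mem_coe, hΩ, mem_Ioo]
      cases s
      · exact FracSobolev.dense_smoothPart_of_bounded hp hα hab (by simpa [Side.sign] using hmem)
      -- For the right direction e x = -x runs over (-b, -a), and integration starts at b.
      · refine FracSobolev.dense_smoothPart_of_bounded (c := -b) (d := -a) hp hα (by linarith)
          fun x => ?_
        rw [hmem]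
        simp [Side.sign, and_comm]
    · obtain rfl : Ω = ⊤ := Opens.ext hΩ
      exact FracSobolev.dense_smoothPart_top hp s hα
  have := FracSobolev.completeSpace (s := s) (p := p) (Ω := Ω) hα
  exact ⟨exists_completion_linearIsometryEquiv _ hdense, hdense⟩

end
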